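/- **Setting.** Let $\mathcal X$ be a finite set with $D\ge 2$ elements, $k:\mathcal X\times\mathcal X\to\mathbb R$ a positive semidefinite kernel with $k(x,x')\le 1$ for all $x,x'$ and $k(x,x)>0$ for all $x$, and $\sigma_n>0$. Let $f\sim GP(0,k)$ on $\mathcal X$; evaluating $f$ at $x$ returns $y=f(x)+\varepsilon$ with i.i.d. noise $\varepsilon\sim N(0,\sigma_n^2)$ independent of $f$. For a finite sequence $A=(a_1,\dots,a_n)$ of points (repetitions allowed), put $K_A=(k(a_i,a_j))_{i,j}$, $k_A(x)=(k(a_i,x))_i$, and let $$\mu_A(x)=k_A(x)^\top (K_A+\sigma_n^2 I)^{-1}y_A,\qquad \sigma_A(x)=\sqrt{k(x,x)-k_A(x)^\top(K_A+\sigma_n^2I)^{-1}k_A(x)}$$ be the posterior mean and standard deviation after observing $y_A$ at $A$; $\sigma_A(x\mid B)$ denotes the posterior standard deviation after observations at both $A$ and $B$. **Algorithm.** Let $m\ge1$ be the batch size. In round $t=0,1,2,\dots$, let $A_t$ be the sequence of the $tm$ points evaluated so far, $\mathcal F_t$ the $\sigma$-algebra generated by these points and their observed values, and $\mu_t=\mu_{A_t}$,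 $\sigma_t=\sigma_{A_t}$. Given $\mathcal F_t$, draw $\tilde f_{t,1},\dots,\tilde f_{t,m}$ independently from the conditional law of $f$ given $\mathcal F_t$ (conditionally independently of $f$, of all the noise and of all earlier draws), put $\tilde f^*_{t,i}=\max_x\tilde f_{t,i}(x)$, and choose successively, for $i=1,\dots,m$, $$x_{t+1,i}\in\operatorname*{arg\,min}_{x\in\mathcal X}\frac{\tilde f^*_{t,i}-\mu_t(x)}{\sigma_t\big(x\mid (x_{t+1,j})_{j<i}\big)}$$ (the Regret-to-Sigma Ratio). Ties are broken by any measurable rule that uses only the data in $\mathcal F_t$, the draws made so far, and possibly extra randomness independent of $f$ and the noise (the draws being conditionally independent of this randomness too, given $\mathcal F_t$). Then all $m$ points are evaluated. **Theorem.** For every $\sigma_n>0$ there is a constant $C>0$, depending only on $\sigma_n$, such that for all $\mathcal X$, $k$, $m\ge1$, every run of the algorithm and all $T\ge1$, the cumulative regret $R_{T,m}=\sum_{t=0}^{T-1}\sum_{i=1}^m\big(\max_x f(x)-f(x_{t+1,i})\big)$ is integrable and $$\mathbb E[R_{T,m}]\le C\,\rho_m\,\sqrt{Tm\,\gamma_{Tm}}\,\sqrt{\log\big(D(Tm)^3\big)}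 .$$ Here the expectation is over $f$, the noise and the algorithm's draws; $\gamma_{n}=\max_{A}I(y_A;f_A)$ is the maximal mutual information over sequences $A$ of $n$ points; and $$\rho_m=\max_{x}\ \max_{0\le\tau<T}\ \max_{A}\ \max_{B}\ \frac{\sigma_A(x)}{\sigma_A(x\mid B)},$$ where $A$ runs over all sequences of $\tau m$ points and $B$ over all sequences of at most $m$ points. More precisely, the bound also holds with $\rho_m$ replaced by $\mathbb E[\hat\rho_m]$, where $\hat\rho_m$ is the (integrable) random variable defined by the same formula with $A$ fixed to be the sequence $A_\tau$ of points that the run actually evaluated before round $\tau$. -/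

import Mathlib

open MeasureTheory ProbabilityTheory
open scoped NNReal ENNReal

namespace BatchTS

noncomputable section

/-! ### Gaussian process prior, posterior mean and posterior standard deviation -/

/-- The law on `X → ℝ` of a Gaussian process on the finite set `X` with mean zero and
covariance `k`. -/
def gpLaw {X : Type*} [Fintype X] [DecidableEq X] (k : X → X → ℝ) : Measure (X → ℝ) :=
  (multivariateGaussian (0 : EuclideanSpace ℝ X) (Matrix.of k)).map
    (fun v : EuclideanSpace ℝ X => (fun x => v x))

/-- The law of one observation noise variable, `N(0, σₙ²)`. -/
def noiseLaw (σn : ℝ) : Measure ℝ := gaussianReal 0 (σn ^ 2).toNNReal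

/-- The covariance matrix `K_A + σₙ² I` of the noisy observations at the points `A`. -/
def gram {X ι : Type*} [DecidableEq ι] (σn : ℝ) (k : X → X → ℝ) (A : ι → X) : Matrix ι ι ℝ :=
  Matrix.of (fun i j => k (A i) (A j)) + σn ^ 2 • (1 : Matrix ι ι ℝ)

/-- Posterior mean at `x` after observing the values `y` (with noise) at the points `A`. -/
def postMean {X ι : Type*} [Fintype ι] [DecidableEq ι] (σn : ℝ) (k : X → X → ℝ)
    (A : ι → X) (y : ι → ℝ) (x : X) : ℝ :=
  (fun i => k (A i) x) ⬝ᵥ ((gram σn k A)⁻¹.mulVec y)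

/-- Posterior standard deviation at `x` after noisy observations at the points `A`
(a finite family, so a point may occur several times). -/
def postSd {X ι : Type*} [Fintype ι] [DecidableEq ι] (σn : ℝ) (k : X → X → ℝ)
    (A : ι → X) (x : X) : ℝ :=
  √(k x x - (fun i => k (A i) x) ⬝ᵥ ((gram σn k A)⁻¹.mulVec (fun i => k (A i) x)))

/-- Posterior standard deviation `σ(x ∣ B)` at `x` after observations at `A` and, additionally,
at the points `B`. -/
def postSdGiven {X ι κ : Type*} [Fintype ι] [DecidableEq ι] [Fintype κ] [DecidableEq κ]
    (σn : ℝ) (k : X → X → ℝ) (A : ι → X) (B : κ → X) (x : X) : ℝ :=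
  postSd σn k (Sum.elim A B) x

/-! ### Maximal information gain -/

/-- Mutual information of two random variables, in nats: the Kullback-Leibler divergence of
their joint law from the product of their laws. -/
def mutualInfo {Ω α β : Type*} [MeasurableSpace Ω] [MeasurableSpace α] [MeasurableSpace β]
    (P : Measure Ω) (Y : Ω → α) (Z : Ω → β) : ℝ≥0∞ :=
  InformationTheory.klDiv (P.map (fun ω => (Y ω, Z ω))) ((P.map Y).prod (P.map Z))

/-- The information gain `I(y_A; f_A)`, where `y_A = f_A + e` with `f` drawn from the prior and
`e` an independent vector of i.i.d. noise variables. -/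
def infoGain {X : Type*} [Fintype X] [DecidableEq X] (σn : ℝ) (k : X → X → ℝ)
    {n : ℕ} (A : Fin n → X) : ℝ :=
  (mutualInfo ((gpLaw k).prod (Measure.pi fun _ : Fin n => noiseLaw σn))
    (fun p => fun j => p.1 (A j) + p.2 j) (fun p => fun j => p.1 (A j))).toReal

/-- The maximal information gain `γₙ` from `n` observations (repeated points are allowed). -/
def maxInfoGain {X : Type*} [Fintype X] [DecidableEq X] (σn : ℝ) (k : X → X → ℝ) (n : ℕ) : ℝ :=
  ⨆ A : Fin n → X, infoGain σn k A

/-! ### The batch algorithm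

Rounds and batch slots are numbered from `0`: `x t ω i` is the `i`-th point of the batch that is
evaluated after `t` complete rounds, `ε ω t i` the noise of that evaluation, and `g t ω i` the
posterior sample drawn for that slot. -/

/-- The points evaluated in the first `t` rounds. -/
def design {Ω X : Type*} {m : ℕ} (x : ℕ → Ω → Fin m → X) (t : ℕ) (ω : Ω) :
    Fin t × Fin m → X :=
  fun p => x p.1 ω p.2

/-- The noisy values observed in the first `t` rounds. -/
def observed {Ω X : Type*} {m : ℕ} (f : Ω → X → ℝ) (ε : Ω → ℕ → Fin m → ℝ)
    (x : ℕ → Ω → Fin m → X) (t : ℕ) (ω : Ω) : Fin t × Fin m → ℝ :=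
  fun p => f ω (x p.1 ω p.2) + ε ω p.1 p.2

/-- The data (points and observed values) of the first `t` rounds; it generates `ℱ_t`. -/
def history {Ω X : Type*} {m : ℕ} (f : Ω → X → ℝ) (ε : Ω → ℕ → Fin m → ℝ)
    (x : ℕ → Ω → Fin m → X) (t : ℕ) (ω : Ω) : (Fin t × Fin m → X) × (Fin t × Fin m → ℝ) :=
  (design x t ω, observed f ε x t ω)

/-- The Regret-to-Sigma Ratio of the candidate `z` for slot `i` after `t` rounds:
`(max g_{t,i} - μ_t(z)) / σ_t(z ∣ points already chosen in this batch)`. -/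
def rsr {Ω X : Type*} {m : ℕ} (σn : ℝ) (k : X → X → ℝ) (f : Ω → X → ℝ)
    (ε : Ω → ℕ → Fin m → ℝ) (g : ℕ → Ω → Fin m → X → ℝ) (x : ℕ → Ω → Fin m → X)
    (t : ℕ) (i : Fin m) (ω : Ω) (z : X) : ℝ :=
  ((⨆ z', g t ω i z') - postMean σn k (design x t ω) (observed f ε x t ω) z) /
    postSdGiven σn k (design x t ω) (fun j : {j : Fin m // j < i} => x t ω j) z

/-- A run, on the probability space `(Ω, P)`, of the batch algorithm that minimizes the
Regret-to-Sigma Ratio, with batch size `m`, kernel `k` and noise variance `σn ^ 2`.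
`f` is the unknown function, `ε` the noise, `g` the Thompson-sampling draws, `x` the chosen
points, and `U` is auxiliary randomness that the algorithm may use to break ties (take a
one-point type for a deterministic rule). -/
structure IsRun {Ω X 𝒰 : Type*} [MeasurableSpace Ω] [Fintype X] [DecidableEq X]
    [MeasurableSpace X] [MeasurableSpace 𝒰] (P : Measure Ω) [IsFiniteMeasure P]
    (σn : ℝ) (k : X → X → ℝ) (m : ℕ)
    (f : Ω → X → ℝ) (ε : Ω → ℕ → Fin m → ℝ) (U : Ω → 𝒰)
    (g : ℕ → Ω → Fin m → X → ℝ) (x : ℕ → Ω → Fin m → X) : Prop where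
  measurable_f : Measurable f
  measurable_ε : Measurable ε
  measurable_U : Measurable U
  measurable_g : ∀ t, Measurable (g t)
  /-- `f` is drawn from the Gaussian process prior. -/
  law_f : P.map f = gpLaw k
  /-- The noise variables are i.i.d. `N(0, σn ^ 2)`. -/
  law_ε : ∀ t i, P.map (fun ω => ε ω t i) = noiseLaw σn
  indep_ε : iIndepFun (fun (p : ℕ × Fin m) ω => ε ω p.1 p.2) P
  /-- `f`, the noise and the tie-breaking randomness are independent. -/
  indep_f_ε : IndepFun f ε P
  indep_U : IndepFun (fun ω => (f ω, ε ω)) U P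
  /-- Conditionally on everything drawn before, the `m` samples of round `t` are independent
  draws from the conditional law of `f` given the history. -/
  draws : ∀ t, ∀ᵐ ω ∂P,
    condDistrib (g t) (fun ω' => (f ω', ε ω', U ω', fun s : Fin t => g s ω')) P
        (f ω, ε ω, U ω, fun s : Fin t => g s ω) =
      Measure.pi (fun _ : Fin m =>
        condDistrib f (history f ε x t) P (history f ε x t ω))
  /-- The batch is chosen from the history, the samples drawn so far, and `U`. -/
  nonanticipating : ∀ t, ∃ φ : 𝒰 × ((Fin t × Fin m → X) × (Fin t × Fin m → ℝ)) ×
      (Fin (t + 1) → Fin m → X → ℝ) → Fin m → X,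
    Measurable φ ∧
      ∀ ω, x t ω = φ (U ω, history f ε x t ω, fun s : Fin (t + 1) => g s ω)
  /-- Each batch point minimizes the Regret-to-Sigma Ratio. -/
  argmin : ∀ t i, ∀ᵐ ω ∂P, ∀ z : X,
    rsr σn k f ε g x t i ω (x t ω i) ≤ rsr σn k f ε g x t i ω z

/-- The cumulative batch regret `R_{T,m}`. -/
def regret {Ω X : Type*} {m : ℕ} (f : Ω → X → ℝ) (x : ℕ → Ω → Fin m → X) (T : ℕ) (ω : Ω) : ℝ :=
  ∑ t ∈ Finset.range T, ∑ i : Fin m, ((⨆ z, f ω z) - f ω (x t ω i))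

/-! ### The ratio `ρ_m` -/

/-- The set of ratios `σ_A(z) / σ_A(z ∣ B)`, where `z` is any point and `B` any family of at most
`m` further points (repetitions allowed). -/
def sdRatios {X ι : Type*} [Fintype ι] [DecidableEq ι] (σn : ℝ) (k : X → X → ℝ) (m : ℕ)
    (A : ι → X) : Set ℝ :=
  {r | ∃ z : X, ∃ j ≤ m, ∃ B : Fin j → X, r = postSd σn k A z / postSdGiven σn k A B z}

/-- `ρ_m` along the realized run: the maximum over the rounds `τ = 0, …, T - 1` of the ratios
for the points actually evaluated before round `τ`. -/
def rhoPath {Ω X : Type*} {m : ℕ} (σn : ℝ) (k : X → X → ℝ) (x : ℕ → Ω → Fin m → X)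
    (T : ℕ) (ω : Ω) : ℝ :=
  sSup {r | ∃ τ < T, r ∈ sdRatios σn k m (design x τ ω)}

/-- `ρ_m` in the worst case: the maximum over the rounds `τ = 0, …, T - 1` and over all
possible choices of the `τ * m` points evaluated before round `τ`. -/
def rho {X : Type*} (σn : ℝ) (k : X → X → ℝ) (T m : ℕ) : ℝ :=
  sSup {r | ∃ τ < T, ∃ A : Fin τ × Fin m → X, r ∈ sdRatios σn k m A}

end

end BatchTS

/-! Given the history, a draw has the law of `f`, so the expected maximum of the draw equals the
expected maximum of `f`. The next batch depends on the history and on internal randomness only, so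
the residual `f - μ_t` has mean zero at each of its points. Hence the expected regret is the sum of
the expectations of `max g - μ_t(x)`, the numerator of the regret-to-sigma ratio at the chosen
point `x`.

Let `z` maximize the draw `g`. By the choice of `x`, this numerator is at most `σ_t(x | batch)`
times `(g z - μ_t(z)) / σ_t(z | batch)`, which is a ratio bounded by `ρ_m` times a standardized
residual of `g`. The standardized residuals are standard Gaussian, so they exceed
`β = √(2 log (D n³))` by an amount that is negligible in expectation. By Cauchy-Schwarz the sum of
the `σ_t(x | batch)` is controlled by the sum of their squares, and since
`v ≤ (1 + σn²) (log (σn² + v) - log σn²)` for `0 ≤ v ≤ 1`, the latter telescopes along the chain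
rule into the information gain. -/

namespace BatchTS

noncomputable section

/-! ### Posterior variance -/

section PosteriorVariance

open scoped RealInnerProductSpace

theorem norm_sum_smul_sq_le {H κ : Type*} [Fintype κ] [SeminormedAddCommGroup H] [NormedSpace ℝ H]
    {v : κ → H} (hv : ∀ j, ‖v j‖ ≤ 1) (w : κ → ℝ) :
    ‖∑ j, w j • v j‖ ^ 2 ≤ Fintype.card κ * ∑ j, w j ^ 2 := by
  have htri : ‖∑ j, w j • v j‖ ≤ ∑ j, |w j| :=
    norm_sum_le_of_le _ fun j _ => by
      rw [norm_smul, Real.norm_eq_abs]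
      exact mul_le_of_le_one_right (abs_nonneg _) (hv j)
  calc ‖∑ j, w j • v j‖ ^ 2 ≤ (∑ j, |w j|) ^ 2 := by gcongr
    _ ≤ Fintype.card κ * ∑ j, |w j| ^ 2 := sq_sum_le_card_mul_sum_sq
    _ = Fintype.card κ * ∑ j, w j ^ 2 := by simp_rw [sq_abs]

theorem add_sq_le_one_add_div_mul {p q N Q s : ℝ} (hs : 0 < s) (hN : 0 ≤ N) (hQ : 0 ≤ Q)
    (hq : q ^ 2 ≤ N * Q) : (p + q) ^ 2 ≤ (1 + N / s) * (p ^ 2 + s * Q) := by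
  have hcross : 2 * p * q ≤ N / s * p ^ 2 + s * Q := by
    refine le_of_sq_le_sq ?_ (by positivity)
    calc (2 * p * q) ^ 2 = 4 * p ^ 2 * q ^ 2 := by ring
      _ ≤ 4 * p ^ 2 * (N * Q) := by gcongr
      _ = 4 * (N / s * p ^ 2) * (s * Q) := by field_simp
      _ ≤ (N / s * p ^ 2 + s * Q) ^ 2 := four_mul_le_sq_add _ _
  calc (p + q) ^ 2 = p ^ 2 + 2 * p * q + q ^ 2 := by ring
    _ ≤ p ^ 2 + (N / s * p ^ 2 + s * Q) + N * Q := by gcongr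
    _ = (1 + N / s) * (p ^ 2 + s * Q) := by field_simp; ring

variable {X ι κ : Type*} [DecidableEq ι] [DecidableEq κ] {σn : ℝ} {k : X → X → ℝ}

theorem kernel_comm (hk : (Matrix.of k).PosSemidef) (z z' : X) : k z z' = k z' z := by
  simpa using hk.isHermitian.apply z' z

-- Moore's theorem, with the operator-valued kernels of `RKHS` specialised to scalar operators.
theorem exists_featureMap.{u} {X : Type u} {k : X → X → ℝ} (hk : (Matrix.of k).PosSemidef) :
    ∃ (H : Type u) (_ : NormedAddCommGroup H) (_ : InnerProductSpace ℝ H) (φ : X → H),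
      ∀ z z', k z z' = ⟪φ z, φ z'⟫ := by
  let K : Matrix X X (ℝ →L[ℝ] ℝ) := .of fun z z' => k z z' • 1
  have hK : K.PosSemidef := by
    have htfae := (RKHS.posSemidef_tfae (K := K)).out 0 2
    refine htfae.2 ⟨Matrix.IsHermitian.ext fun z z' => ?_, fun v => ?_⟩
    · ext; simp [K, kernel_comm hk z' z]
    · rw [RCLike.re_to_real]
      refine (hk.2 v).trans_eq (Finsupp.sum_congr fun z _ => Finsupp.sum_congr fun z' _ => ?_)
      simp [K, kernel_comm hk z' z]; ring
  have : Fact K.PosSemidef := ⟨hK⟩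
  refine ⟨RKHS.OfKernel K, inferInstance, inferInstance,
    fun z => RKHS.kerFun (RKHS.OfKernel K) z (1 : ℝ), fun z z' => ?_⟩
  rw [← RKHS.kernel_inner, RKHS.OfKernel.kernel_ofKernel]
  simp [K, kernel_comm hk z' z]

theorem posDef_gram (hk : (Matrix.of k).PosSemidef) (hσn : 0 < σn) (A : ι → X) :
    (gram σn k A).PosDef :=
  .posSemidef_add (hk.submatrix A) (Matrix.PosDef.one.smul (by positivity))

theorem transpose_gram (hk : (Matrix.of k).PosSemidef) (A : ι → X) :
    (gram σn k A).transpose = gram σn k A := by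
  ext i j
  simp [gram, Matrix.one_apply, kernel_comm hk (A i), eq_comm]

variable [Fintype ι] [Fintype κ]

/-- The posterior variance `σ_A(x)²`, without the square root of `postSd`. -/
def postVar (σn : ℝ) (k : X → X → ℝ) (A : ι → X) (x : X) : ℝ :=
  k x x - (fun i => k (A i) x) ⬝ᵥ ((gram σn k A)⁻¹.mulVec (fun i => k (A i) x))

/-- The weights `(K_A + σₙ² I)⁻¹ k_A(x)` with which the posterior mean at `x` combines the
observations at `A`. -/
def postWeight (σn : ℝ) (k : X → X → ℝ) (A : ι → X) (x : X) : ι → ℝ :=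
  (gram σn k A)⁻¹.mulVec (fun i => k (A i) x)

/-- The mean squared error of the linear predictor `∑ i, w i * y i` of `f x` from the noisy
observations `y` at `A`, written in terms of the kernel. -/
def predErr (σn : ℝ) (k : X → X → ℝ) (A : ι → X) (x : X) (w : ι → ℝ) : ℝ :=
  k x x - 2 * (w ⬝ᵥ fun i => k (A i) x) + w ⬝ᵥ (gram σn k A).mulVec w

theorem postSd_eq_sqrt (A : ι → X) (x : X) : postSd σn k A x = √(postVar σn k A x) := rfl

theorem isUnit_det_gram (hk : (Matrix.of k).PosSemidef) (hσn : 0 < σn) (A : ι → X) :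
    IsUnit (gram σn k A).det :=
  (posDef_gram hk hσn A).det_pos.ne'.isUnit

theorem gram_mulVec_postWeight (hk : (Matrix.of k).PosSemidef) (hσn : 0 < σn)
    (A : ι → X) (x : X) :
    (gram σn k A).mulVec (postWeight σn k A x) = fun i => k (A i) x := by
  rw [postWeight, Matrix.mulVec_mulVec, Matrix.mul_nonsing_inv _ (isUnit_det_gram hk hσn A),
    Matrix.one_mulVec]

theorem postMean_eq_dotProduct (hk : (Matrix.of k).PosSemidef) (A : ι → X) (y : ι → ℝ) (x : X) :
    postMean σn k A y x = postWeight σn k A x ⬝ᵥ y := by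
  rw [postMean, postWeight, Matrix.dotProduct_mulVec, ← Matrix.mulVec_transpose,
    Matrix.transpose_nonsing_inv, transpose_gram hk]

theorem postVar_eq_sub_dotProduct (A : ι → X) (x : X) :
    postVar σn k A x = k x x - postWeight σn k A x ⬝ᵥ fun i => k (A i) x := by
  rw [postVar, dotProduct_comm, postWeight]

theorem predErr_eq_postVar_add (hk : (Matrix.of k).PosSemidef) (hσn : 0 < σn)
    (A : ι → X) (x : X) (w : ι → ℝ) :
    predErr σn k A x w = postVar σn k A x +
      (w - postWeight σn k A x) ⬝ᵥ (gram σn k A).mulVec (w - postWeight σn k A x) := by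
  have hsymm : postWeight σn k A x ⬝ᵥ (gram σn k A).mulVec w =
      w ⬝ᵥ (gram σn k A).mulVec (postWeight σn k A x) := by
    rw [Matrix.dotProduct_mulVec, ← Matrix.mulVec_transpose, transpose_gram hk, dotProduct_comm]
  rw [Matrix.mulVec_sub, dotProduct_sub, sub_dotProduct, sub_dotProduct, hsymm,
    gram_mulVec_postWeight hk hσn, predErr, postVar_eq_sub_dotProduct]
  ring

theorem postVar_le_predErr (hk : (Matrix.of k).PosSemidef) (hσn : 0 < σn)
    (A : ι → X) (x : X) (w : ι → ℝ) : postVar σn k A x ≤ predErr σn k A x w := by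
  rw [predErr_eq_postVar_add hk hσn, le_add_iff_nonneg_right]
  exact (posDef_gram hk hσn A).posSemidef.dotProduct_mulVec_nonneg _

theorem predErr_postWeight (hk : (Matrix.of k).PosSemidef) (hσn : 0 < σn)
    (A : ι → X) (x : X) : predErr σn k A x (postWeight σn k A x) = postVar σn k A x := by
  simp [predErr_eq_postVar_add hk hσn]

theorem predErr_eq_norm_sq_add {H : Type*} [NormedAddCommGroup H] [InnerProductSpace ℝ H]
    {φ : X → H} (hφ : ∀ z z', k z z' = ⟪φ z, φ z'⟫) (A : ι → X) (x : X) (w : ι → ℝ) :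
    predErr σn k A x w = ‖φ x - ∑ i, w i • φ (A i)‖ ^ 2 + σn ^ 2 * ∑ i, w i ^ 2 := by
  have hcross : (w ⬝ᵥ fun i => k (A i) x) = ⟪φ x, ∑ i, w i • φ (A i)⟫ := by
    simp [dotProduct, inner_sum, real_inner_smul_right, hφ, real_inner_comm]
  have hgram : w ⬝ᵥ (gram σn k A).mulVec w =
      ‖∑ i, w i • φ (A i)‖ ^ 2 + σn ^ 2 * ∑ i, w i ^ 2 := by
    rw [← real_inner_self_eq_norm_sq, sum_inner, gram, Matrix.add_mulVec, dotProduct_add]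
    congr 1
    · simp only [inner_sum, real_inner_smul_left, real_inner_smul_right, dotProduct,
        Matrix.mulVec, Matrix.of_apply, hφ, Finset.mul_sum]
      exact Finset.sum_congr rfl fun i _ => Finset.sum_congr rfl fun j _ => by ring
    · simp [Matrix.smul_mulVec, dotProduct, pow_two, Finset.mul_sum, mul_left_comm]
  rw [predErr, hcross, hgram, norm_sub_sq_real, hφ, real_inner_self_eq_norm_sq]
  ring

theorem postVar_pos (hk : (Matrix.of k).PosSemidef) (hσn : 0 < σn)
    (A : ι → X) {x : X} (hx : 0 < k x x) : 0 < postVar σn k A x := by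
  obtain ⟨H, _, _, φ, hφ⟩ := exists_featureMap hk
  rw [← predErr_postWeight hk hσn, predErr_eq_norm_sq_add hφ]
  set w := postWeight σn k A x
  by_cases hw : w = 0
  · have : 0 < ‖φ x‖ ^ 2 := by rwa [← real_inner_self_eq_norm_sq, ← hφ]
    simpa [hw] using this
  · obtain ⟨i, hi⟩ := Function.ne_iff.1 hw
    have hsum : 0 < ∑ i, w i ^ 2 :=
      Finset.sum_pos' (fun _ _ => sq_nonneg _) ⟨i, Finset.mem_univ _, sq_pos_of_ne_zero hi⟩
    exact add_pos_of_nonneg_of_pos (sq_nonneg _) (mul_pos (pow_pos hσn 2) hsum)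

theorem postVar_le_self (hk : (Matrix.of k).PosSemidef) (hσn : 0 < σn)
    (A : ι → X) (x : X) : postVar σn k A x ≤ k x x := by
  simpa [predErr] using postVar_le_predErr hk hσn A x 0

theorem postSd_pos (hk : (Matrix.of k).PosSemidef) (hσn : 0 < σn)
    (A : ι → X) {x : X} (hx : 0 < k x x) : 0 < postSd σn k A x :=
  Real.sqrt_pos.2 (postVar_pos hk hσn A hx)

theorem postSd_sq (hk : (Matrix.of k).PosSemidef) (hσn : 0 < σn)
    (A : ι → X) {x : X} (hx : 0 < k x x) : postSd σn k A x ^ 2 = postVar σn k A x :=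
  Real.sq_sqrt (postVar_pos hk hσn A hx).le

-- Forgetting the weights at `B` in the optimal predictor from `A` and `B` gives a predictor from
-- `A` whose error exceeds that of the former only by the share of `B` in the prediction.
theorem postVar_le_mul_postVar_sumElim (hk : (Matrix.of k).PosSemidef) (hσn : 0 < σn)
    (hk_le : ∀ z, k z z ≤ 1) (A : ι → X) (B : κ → X) (x : X) :
    postVar σn k A x ≤
      (1 + Fintype.card κ / σn ^ 2) * postVar σn k (Sum.elim A B) x := by
  obtain ⟨H, _, _, φ, hφ⟩ := exists_featureMap hk
  have hφ_le : ∀ j, ‖φ (B j)‖ ≤ 1 := fun j => by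
    rw [← sq_le_one_iff₀ (norm_nonneg _), ← real_inner_self_eq_norm_sq, ← hφ]
    exact hk_le _
  set w := postWeight σn k (Sum.elim A B) x
  set r := φ x - ∑ i, w (.inl i) • φ (A i) - ∑ j, w (.inr j) • φ (B j)
  have hjoint : postVar σn k (Sum.elim A B) x =
      ‖r‖ ^ 2 + σn ^ 2 * ∑ j, w (.inr j) ^ 2 + σn ^ 2 * ∑ i, w (.inl i) ^ 2 := by
    rw [← predErr_postWeight hk hσn, predErr_eq_norm_sq_add hφ]
    simp only [Fintype.sum_sum_type, Sum.elim_inl, Sum.elim_inr, ← sub_sub]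
    ring
  have hnorm : ‖φ x - ∑ i, w (.inl i) • φ (A i)‖ ^ 2 ≤
      (1 + Fintype.card κ / σn ^ 2) * (‖r‖ ^ 2 + σn ^ 2 * ∑ j, w (.inr j) ^ 2) := by
    refine le_trans ?_ (add_sq_le_one_add_div_mul (by positivity) (by positivity)
      (by positivity) (norm_sum_smul_sq_le hφ_le fun j => w (.inr j)))
    gcongr
    exact norm_le_norm_sub_add _ _
  calc postVar σn k A x
      ≤ predErr σn k A x fun i => w (.inl i) := postVar_le_predErr hk hσn A x _
    _ = ‖φ x - ∑ i, w (.inl i) • φ (A i)‖ ^ 2 + 1 * (σn ^ 2 * ∑ i, w (.inl i) ^ 2) := by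
        rw [predErr_eq_norm_sq_add hφ, one_mul]
    _ ≤ _ := by
        rw [hjoint, mul_add]
        gcongr
        exact le_add_of_nonneg_right (by positivity)

theorem postSd_div_postSdGiven_le (hk : (Matrix.of k).PosSemidef) (hσn : 0 < σn)
    (hk_le : ∀ z, k z z ≤ 1) (A : ι → X) (B : κ → X) {x : X} (hx : 0 < k x x) :
    postSd σn k A x / postSdGiven σn k A B x ≤ √(1 + Fintype.card κ / σn ^ 2) := by
  rw [postSdGiven, div_le_iff₀ (postSd_pos hk hσn _ hx), postSd_eq_sqrt, postSd_eq_sqrt,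
    ← Real.sqrt_mul (by positivity)]
  exact Real.sqrt_le_sqrt (postVar_le_mul_postVar_sumElim hk hσn hk_le A B x)

end PosteriorVariance

/-! ### Determinant of the Gram matrix -/

section GramDet

variable {X ι κ : Type*} [DecidableEq ι] [DecidableEq κ] {σn : ℝ} {k : X → X → ℝ}

theorem gram_comp_equiv (A : ι → X) (e : κ ≃ ι) :
    gram σn k (A ∘ e) = (gram σn k A).submatrix e e := by
  ext i j
  simp [gram, Matrix.one_apply]

variable [Fintype ι] [Fintype κ]

theorem det_gram_congr {A : ι → X} {B : κ → X} (e : κ ≃ ι) (h : ∀ i, A (e i) = B i) :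
    (gram σn k B).det = (gram σn k A).det := by
  rw [← funext h, ← Function.comp_def, gram_comp_equiv, Matrix.det_submatrix_equiv_self]

theorem postVar_congr {A : ι → X} {B : κ → X} (e : κ ≃ ι) (h : ∀ i, A (e i) = B i) (x : X) :
    postVar σn k B x = postVar σn k A x := by
  have hvec : (fun i => k (A (e i)) x) = (fun i => k (A i) x) ∘ e := rfl
  rw [← funext h, ← Function.comp_def, postVar, gram_comp_equiv, Matrix.inv_submatrix_equiv,
    postVar, Function.comp_def, hvec, Matrix.submatrix_mulVec_equiv,
    comp_equiv_dotProduct_comp_equiv, Function.comp_assoc, e.self_comp_symm, Function.comp_id]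

theorem det_gram_sumElim_of_unique [Unique κ] (hk : (Matrix.of k).PosSemidef) (hσn : 0 < σn)
    (A : ι → X) (b : κ → X) :
    (gram σn k (Sum.elim A b)).det =
      (gram σn k A).det * (σn ^ 2 + postVar σn k A (b default)) := by
  have hblocks : gram σn k (Sum.elim A b) =
      Matrix.fromBlocks (gram σn k A) (Matrix.of fun i _ => k (A i) (b default))
        (Matrix.of fun _ i => k (b default) (A i))
        (Matrix.of fun _ _ => k (b default) (b default) + σn ^ 2) := by
    ext (i | i) (j | j) <;> simp [gram, Matrix.one_apply, Subsingleton.elim _ (default : κ)]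
  have := Matrix.invertibleOfIsUnitDet _ (isUnit_det_gram hk hσn A)
  rw [hblocks, Matrix.det_fromBlocks₁₁, Matrix.det_unique (n := κ)]
  simp only [Matrix.sub_apply, Matrix.of_apply, Matrix.invOf_eq_nonsing_inv, postVar,
    Matrix.mul_assoc, Matrix.mul_apply, dotProduct, Matrix.mulVec, kernel_comm hk (b default)]
  ring

theorem det_gram_sumElim_fin (hk : (Matrix.of k).PosSemidef) (hσn : 0 < σn)
    (A : ι → X) {m : ℕ} (b : Fin m → X) :
    (gram σn k (Sum.elim A b)).det = (gram σn k A).det *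
      ∏ i, (σn ^ 2 + postVar σn k (Sum.elim A fun j : {j : Fin m // j < i} => b j) (b i)) := by
  induction m with
  | zero =>
    have hA : (gram σn k (Sum.elim A b)).det = (gram σn k A).det :=
      det_gram_congr (Equiv.sumEmpty ι (Fin 0)) (by rintro (i | i); exacts [rfl, i.elim0])
    simp [hA]
  | succ m ih =>
    have hlast : (gram σn k (Sum.elim A b)).det = (gram σn k (Sum.elim (Sum.elim A
        fun i : Fin m => b i.castSucc) fun _ : Fin 1 => b (Fin.last m))).det := by
      refine (det_gram_congr ((Equiv.sumAssoc ι (Fin m) (Fin 1)).trans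
        ((Equiv.refl ι).sumCongr finSumFinEquiv)) ?_).symm
      rintro ((i | i) | i)
      exacts [rfl, rfl, congrArg b (Fin.ext (by simp))]
    rw [hlast, det_gram_sumElim_of_unique hk hσn, ih, Fin.prod_univ_castSucc, mul_assoc]
    congr! 3 with i
    · refine congrArg (σn ^ 2 + ·) (postVar_congr ((Equiv.refl ι).sumCongr
        { toFun j := ⟨j.1.castSucc, j.2⟩
          invFun j := ⟨j.1.castPred (Fin.ne_last_of_lt j.2), j.2⟩ }) ?_ _)
      rintro (j | j) <;> rfl
    · refine postVar_congr ((Equiv.refl ι).sumCongr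
        { toFun j := ⟨j.castSucc, Fin.castSucc_lt_last j⟩
          invFun j := j.1.castPred j.2.ne }) ?_ _
      rintro (j | j) <;> rfl

theorem det_gram_batches (hk : (Matrix.of k).PosSemidef) (hσn : 0 < σn) {m : ℕ}
    (b : ℕ → Fin m → X) (T : ℕ) :
    (gram σn k (fun p : Fin T × Fin m => b p.1 p.2)).det =
      ∏ t ∈ Finset.range T, ∏ i, (σn ^ 2 + postVar σn k
        (Sum.elim (fun p : Fin t × Fin m => b p.1 p.2) fun j : {j : Fin m // j < i} => b t j)
        (b t i)) := by
  induction T with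
  | zero => simp
  | succ T ih =>
    rw [Finset.prod_range_succ, ← ih, ← det_gram_sumElim_fin hk hσn]
    refine det_gram_congr (((finSumFinEquiv (m := T) (n := 1)).symm.prodCongr
      (Equiv.refl _)).trans ((Equiv.sumProdDistrib _ _ _).trans
        ((Equiv.refl _).sumCongr (Equiv.uniqueProd _ _)))) ?_
    rintro ⟨t, i⟩
    cases t using Fin.lastCases <;> simp
    
end GramDet

/-! ### The Gaussian observation model at fixed points -/

section Residual

variable {X ι : Type*} {σn : ℝ} {k : X → X → ℝ}

/-- The noisy values `y_A = f_A + e` seen when the function `v` is observed at the points `A`. -/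
def observe (A : ι → X) (v : X → ℝ) (e : ι → ℝ) : ι → ℝ := fun i => v (A i) + e i

variable [Fintype ι] [DecidableEq ι]

/-- The error `v - μ_A` of the posterior mean after observing `v` at `A` with noise `e`. -/
def residual (σn : ℝ) (k : X → X → ℝ) (A : ι → X) (v : X → ℝ) (e : ι → ℝ) : X → ℝ :=
  fun z => v z - postMean σn k A (observe A v e) z

theorem residual_eq_sub_sum (hk : (Matrix.of k).PosSemidef) (A : ι → X) (v : X → ℝ) (e : ι → ℝ)
    (z : X) :
    residual σn k A v e z = v z - ∑ i, postWeight σn k A z i * observe A v e i := by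
  rw [residual, postMean_eq_dotProduct hk, dotProduct]

end Residual

section Model

variable {Ω X ι : Type*} [MeasurableSpace Ω] [Fintype X] [DecidableEq X]
  {P : Measure Ω} {σn : ℝ} {k : X → X → ℝ} {f : Ω → X → ℝ} {e : Ω → ι → ℝ}

/-- The Bayesian observation model: `f` is a Gaussian process with covariance `k`, and `e` is an
independent family of i.i.d. noise variables. The points at which `f` is observed are not part of
the model. -/
structure IsGPModel (P : Measure Ω) (σn : ℝ) (k : X → X → ℝ) (f : Ω → X → ℝ) (e : Ω → ι → ℝ) :
    Prop where
  measurable_f : Measurable f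
  measurable_e : Measurable e
  law_f : P.map f = gpLaw k
  law_e : ∀ i, P.map (fun ω => e ω i) = noiseLaw σn
  indep_e : iIndepFun (fun i ω => e ω i) P
  indep : IndepFun f e P

instance isGaussian_gpLaw : IsGaussian (gpLaw k) :=
  isGaussian_map (μ := multivariateGaussian (0 : EuclideanSpace ℝ X) (Matrix.of k))
    (EuclideanSpace.equiv X ℝ).toContinuousLinearMap

instance isGaussian_noiseLaw : IsGaussian (noiseLaw σn) :=
  isGaussian_gaussianReal _ _

theorem integral_gpLaw (z : X) : ∫ v, v z ∂(gpLaw k) = 0 := by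
  rw [gpLaw, integral_map (f := fun v : X → ℝ => v z) (by fun_prop)
    (measurable_pi_apply z).aestronglyMeasurable]
  have h := (EuclideanSpace.proj (𝕜 := ℝ) z).integral_comp_comm
    (IsGaussian.integrable_id (μ := multivariateGaussian (0 : EuclideanSpace ℝ X) (Matrix.of k)))
  simpa using h

theorem covariance_gpLaw (hk : (Matrix.of k).PosSemidef) (z z' : X) :
    cov[fun v => v z, fun v => v z'; gpLaw k] = k z z' := by
  rw [gpLaw, covariance_map_fun (measurable_pi_apply _).aestronglyMeasurable
    (measurable_pi_apply _).aestronglyMeasurable (by fun_prop)]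
  exact covariance_eval_multivariateGaussian hk z z'

theorem isGPModel_prod [Fintype ι] :
    IsGPModel ((gpLaw k).prod (Measure.pi fun _ : ι => noiseLaw σn)) σn k Prod.fst Prod.snd := by
  have hsnd := measurePreserving_snd (μ := gpLaw k) (ν := Measure.pi fun _ : ι => noiseLaw σn)
  have hlaw (i : ι) : ((gpLaw k).prod (Measure.pi fun _ : ι => noiseLaw σn)).map
      (fun p => p.2 i) = noiseLaw σn :=
    ((measurePreserving_eval (fun _ : ι => noiseLaw σn) i).comp hsnd).map_eq
  refine ⟨measurable_fst, measurable_snd, measurePreserving_fst.map_eq, hlaw, ?_,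
    indepFun_prod measurable_id measurable_id⟩
  rw [iIndepFun_iff_map_fun_eq_pi_map fun i => by fun_prop]
  simp_rw [hlaw]
  exact hsnd.map_eq

namespace IsGPModel

theorem isProbabilityMeasure (h : IsGPModel P σn k f e) : IsProbabilityMeasure P :=
  h.indep_e.isProbabilityMeasure

theorem measurable_e_apply (h : IsGPModel P σn k f e) (i : ι) : Measurable fun ω => e ω i :=
  (measurable_pi_apply i).comp h.measurable_e

theorem hasGaussianLaw_f (h : IsGPModel P σn k f e) : HasGaussianLaw f P :=
  ⟨by rw [h.law_f]; infer_instance⟩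

theorem hasGaussianLaw_e_apply (h : IsGPModel P σn k f e) (i : ι) :
    HasGaussianLaw (fun ω => e ω i) P :=
  ⟨by rw [h.law_e]; infer_instance⟩

theorem hasGaussianLaw_e [Finite ι] (h : IsGPModel P σn k f e) : HasGaussianLaw e P :=
  have := Fintype.ofFinite ι
  h.indep_e.hasGaussianLaw h.hasGaussianLaw_e_apply

theorem memLp_f (h : IsGPModel P σn k f e) (z : X) : MemLp (fun ω => f ω z) 2 P :=
  (h.hasGaussianLaw_f.map_fun (ContinuousLinearMap.proj (R := ℝ) z)).memLp_two

theorem memLp_e (h : IsGPModel P σn k f e) (i : ι) : MemLp (fun ω => e ω i) 2 P :=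
  (h.hasGaussianLaw_e_apply i).memLp_two

theorem memLp_observe (h : IsGPModel P σn k f e) (A : ι → X) (i : ι) :
    MemLp (fun ω => observe A (f ω) (e ω) i) 2 P :=
  (h.memLp_f (A i)).add (h.memLp_e i)

theorem integral_f (h : IsGPModel P σn k f e) (z : X) : ∫ ω, f ω z ∂P = 0 := by
  rw [← integral_gpLaw (k := k) z, ← h.law_f, integral_map h.measurable_f.aemeasurable
    (measurable_pi_apply _).aestronglyMeasurable]

theorem integral_e (h : IsGPModel P σn k f e) (i : ι) : ∫ ω, e ω i ∂P = 0 := by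
  have hid : ∫ y, y ∂(noiseLaw σn) = 0 := integral_id_gaussianReal
  rw [← hid, ← h.law_e i, integral_map (h.measurable_e_apply i).aemeasurable (by fun_prop)]

theorem integral_observe (h : IsGPModel P σn k f e) (A : ι → X) (i : ι) :
    ∫ ω, observe A (f ω) (e ω) i ∂P = 0 := by
  have := h.isProbabilityMeasure
  simp only [observe]
  rw [integral_add ((h.memLp_f (A i)).integrable one_le_two)
    ((h.memLp_e i).integrable one_le_two), h.integral_f, h.integral_e, add_zero]

theorem covariance_f (h : IsGPModel P σn k f e) (hk : (Matrix.of k).PosSemidef) (z z' : X) :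
    cov[fun ω => f ω z, fun ω => f ω z'; P] = k z z' := by
  rw [← covariance_gpLaw hk z z', ← h.law_f,
    covariance_map_fun (measurable_pi_apply _).aestronglyMeasurable
      (measurable_pi_apply _).aestronglyMeasurable h.measurable_f.aemeasurable]

theorem covariance_f_e (h : IsGPModel P σn k f e) (z : X) (i : ι) :
    cov[fun ω => f ω z, fun ω => e ω i; P] = 0 :=
  (h.indep.comp (measurable_pi_apply z) (measurable_pi_apply i)).covariance_eq_zero
    (h.memLp_f z) (h.memLp_e i)

theorem covariance_f_observe (h : IsGPModel P σn k f e) (hk : (Matrix.of k).PosSemidef)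
    (A : ι → X) (z : X) (i : ι) :
    cov[fun ω => f ω z, fun ω => observe A (f ω) (e ω) i; P] = k (A i) z := by
  have := h.isProbabilityMeasure
  refine (covariance_add_right (h.memLp_f z) (h.memLp_f (A i)) (h.memLp_e i)).trans ?_
  rw [h.covariance_f hk, h.covariance_f_e, add_zero, kernel_comm hk]

theorem integral_e_sq (h : IsGPModel P σn k f e) (i : ι) : ∫ ω, e ω i ^ 2 ∂P = σn ^ 2 := by
  have hm := (h.measurable_e_apply i).aemeasurable (μ := P)
  rw [← variance_of_integral_eq_zero hm (h.integral_e i), ← variance_id_map hm, h.law_e, noiseLaw,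
    variance_id_gaussianReal, Real.coe_toNNReal _ (sq_nonneg _)]

variable [DecidableEq ι]

theorem covariance_e (h : IsGPModel P σn k f e) (i j : ι) :
    cov[fun ω => e ω i, fun ω => e ω j; P] = if i = j then σn ^ 2 else 0 := by
  split_ifs with hij
  · subst hij
    have hm := (h.measurable_e_apply i).aemeasurable (μ := P)
    rw [covariance_self hm, variance_of_integral_eq_zero hm (h.integral_e i), h.integral_e_sq]
  · exact (h.indep_e.indepFun hij).covariance_eq_zero (h.memLp_e i) (h.memLp_e j)

theorem covariance_observe (h : IsGPModel P σn k f e) (hk : (Matrix.of k).PosSemidef)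
    (A : ι → X) (i j : ι) :
    cov[fun ω => observe A (f ω) (e ω) i, fun ω => observe A (f ω) (e ω) j; P] =
      gram σn k A i j := by
  have := h.isProbabilityMeasure
  have hj := h.memLp_observe A j
  have hnoise : cov[fun ω => e ω i, fun ω => observe A (f ω) (e ω) j; P] =
      if i = j then σn ^ 2 else 0 := by
    refine (covariance_add_right (h.memLp_e i) (h.memLp_f (A j)) (h.memLp_e j)).trans ?_
    rw [h.covariance_e, covariance_comm, h.covariance_f_e, zero_add]
  refine (covariance_add_left (h.memLp_f (A i)) (h.memLp_e i) hj).trans ?_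
  rw [h.covariance_f_observe hk, hnoise, kernel_comm hk]
  simp [gram, Matrix.one_apply]

theorem integral_observe_mul_observe (h : IsGPModel P σn k f e) (hk : (Matrix.of k).PosSemidef)
    (A : ι → X) (i j : ι) :
    ∫ ω, observe A (f ω) (e ω) i * observe A (f ω) (e ω) j ∂P = gram σn k A i j := by
  have := h.isProbabilityMeasure
  have hcov := covariance_eq_sub (h.memLp_observe A i) (h.memLp_observe A j)
  rw [h.covariance_observe hk, h.integral_observe, zero_mul, sub_zero] at hcov
  exact hcov.symm

variable [Fintype ι]

theorem hasGaussianLaw_residual_observe (h : IsGPModel P σn k f e) (hk : (Matrix.of k).PosSemidef)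
    (A : ι → X) :
    HasGaussianLaw
      (fun ω => (residual σn k A (f ω) (e ω), observe A (f ω) (e ω))) P := by
  let F (z : X) : (X → ℝ) × (ι → ℝ) →L[ℝ] ℝ :=
    (ContinuousLinearMap.proj z).comp (ContinuousLinearMap.fst ℝ (X → ℝ) (ι → ℝ))
  let E (i : ι) : (X → ℝ) × (ι → ℝ) →L[ℝ] ℝ :=
    (ContinuousLinearMap.proj i).comp (ContinuousLinearMap.snd ℝ (X → ℝ) (ι → ℝ))
  let Y (i : ι) : (X → ℝ) × (ι → ℝ) →L[ℝ] ℝ := F (A i) + E i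
  let L : (X → ℝ) × (ι → ℝ) →L[ℝ] (X → ℝ) × (ι → ℝ) :=
    (ContinuousLinearMap.pi fun z => F z - ∑ i, postWeight σn k A z i • Y i).prod
      (ContinuousLinearMap.pi Y)
  have hL (v : X → ℝ) (e : ι → ℝ) : L (v, e) = (residual σn k A v e, observe A v e) := by
    ext
    · simp [L, F, E, Y, residual_eq_sub_sum hk, observe, mul_add]
    · simp [L, F, E, Y, observe]
  simp_rw [← hL]
  exact (h.indep.hasGaussianLaw h.hasGaussianLaw_f h.hasGaussianLaw_e).map_fun L

theorem memLp_residual (h : IsGPModel P σn k f e) (hk : (Matrix.of k).PosSemidef) (A : ι → X)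
    (z : X) : MemLp (fun ω => residual σn k A (f ω) (e ω) z) 2 P :=
  ((h.hasGaussianLaw_residual_observe hk A).fst.map_fun
    (ContinuousLinearMap.proj (R := ℝ) z)).memLp_two

theorem integral_residual (h : IsGPModel P σn k f e) (hk : (Matrix.of k).PosSemidef) (A : ι → X)
    (z : X) : ∫ ω, residual σn k A (f ω) (e ω) z ∂P = 0 := by
  have := h.isProbabilityMeasure
  have hw (i : ι) : Integrable (fun ω => postWeight σn k A z i * observe A (f ω) (e ω) i) P :=
    ((h.memLp_observe A i).integrable one_le_two).const_mul _
  simp_rw [residual_eq_sub_sum hk]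
  rw [integral_sub ((h.memLp_f z).integrable one_le_two) (integrable_finsetSum _ fun i _ => hw i),
    integral_finsetSum _ fun i _ => hw i, h.integral_f]
  simp [integral_const_mul, h.integral_observe]

theorem covariance_residual_left (h : IsGPModel P σn k f e) (hk : (Matrix.of k).PosSemidef)
    (A : ι → X) (z : X) {Y : Ω → ℝ} (hY : MemLp Y 2 P) :
    cov[fun ω => residual σn k A (f ω) (e ω) z, Y; P] = cov[fun ω => f ω z, Y; P] -
      ∑ i, postWeight σn k A z i * cov[fun ω => observe A (f ω) (e ω) i, Y; P] := by
  have := h.isProbabilityMeasure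
  have hw (i : ι) : MemLp (fun ω => postWeight σn k A z i * observe A (f ω) (e ω) i) 2 P :=
    (h.memLp_observe A i).const_mul _
  simp_rw [residual_eq_sub_sum hk]
  rw [covariance_fun_sub_left (h.memLp_f z) (memLp_finsetSum _ fun i _ => hw i) hY,
    covariance_fun_sum_left hw hY]
  simp_rw [covariance_const_mul_left]

theorem covariance_residual_observe (h : IsGPModel P σn k f e) (hk : (Matrix.of k).PosSemidef)
    (hσn : 0 < σn) (A : ι → X) (z : X) (j : ι) :
    cov[fun ω => residual σn k A (f ω) (e ω) z, fun ω => observe A (f ω) (e ω) j; P] = 0 := by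
  have hnormal := congrFun (gram_mulVec_postWeight hk hσn A z) j
  have hsymm (i : ι) : gram σn k A i j = gram σn k A j i :=
    congrFun (congrFun (transpose_gram hk A) j) i
  rw [h.covariance_residual_left hk A z (h.memLp_observe A j), h.covariance_f_observe hk]
  simp_rw [h.covariance_observe hk, hsymm, ← hnormal, Matrix.mulVec, dotProduct, mul_comm, sub_self]

theorem indepFun_residual_observe (h : IsGPModel P σn k f e) (hk : (Matrix.of k).PosSemidef)
    (hσn : 0 < σn) (A : ι → X) :
    IndepFun (fun ω => residual σn k A (f ω) (e ω)) (fun ω => observe A (f ω) (e ω)) P :=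
  (h.hasGaussianLaw_residual_observe hk A).indepFun_of_covariance_eval
    (X := fun z ω => residual σn k A (f ω) (e ω) z) (Y := fun i ω => observe A (f ω) (e ω) i)
    fun z j => h.covariance_residual_observe hk hσn A z j

theorem variance_residual (h : IsGPModel P σn k f e) (hk : (Matrix.of k).PosSemidef)
    (hσn : 0 < σn) (A : ι → X) (z : X) :
    Var[fun ω => residual σn k A (f ω) (e ω) z; P] = postVar σn k A z := by
  have hr := h.memLp_residual hk A z
  have hro (i : ι) : cov[fun ω => observe A (f ω) (e ω) i,
      fun ω => residual σn k A (f ω) (e ω) z; P] = 0 := by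
    rw [covariance_comm, h.covariance_residual_observe hk hσn]
  rw [← covariance_self hr.aemeasurable, h.covariance_residual_left hk A z hr, covariance_comm,
    h.covariance_residual_left hk A z (h.memLp_f z), h.covariance_f hk]
  simp_rw [hro, mul_zero, Finset.sum_const_zero, sub_zero, covariance_comm _ (fun ω => f ω z),
    h.covariance_f_observe hk]
  rw [postVar_eq_sub_dotProduct, dotProduct]

theorem map_residual (h : IsGPModel P σn k f e) (hk : (Matrix.of k).PosSemidef) (hσn : 0 < σn)
    (A : ι → X) (z : X) :
    P.map (fun ω => residual σn k A (f ω) (e ω) z) =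
      gaussianReal 0 (postVar σn k A z).toNNReal := by
  have hlaw := ((h.hasGaussianLaw_residual_observe hk A).fst.map_fun
    (ContinuousLinearMap.proj (R := ℝ) z)).map_eq_gaussianReal
  simp only [ContinuousLinearMap.proj_apply] at hlaw
  rw [hlaw, h.integral_residual hk, h.variance_residual hk hσn]

end IsGPModel

end Model

/-! ### Gaussian densities and the information gain -/

section Density

variable {ι : Type*}

theorem isGaussian_ext_pi [Finite ι] {μ ν : Measure (ι → ℝ)} [IsGaussian μ] [IsGaussian ν]
    (hm : ∀ i, ∫ v, v i ∂μ = ∫ v, v i ∂ν)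
    (hc : ∀ i j, cov[fun v => v i, fun v => v j; μ] = cov[fun v => v i, fun v => v j; ν]) :
    μ = ν := by
  classical
  have := Fintype.ofFinite ι
  let π (i : ι) : StrongDual ℝ (ι → ℝ) := ContinuousLinearMap.proj i
  have hexp (L : StrongDual ℝ (ι → ℝ)) : ∃ c : ι → ℝ, L = ∑ i, c i • π i := by
    refine ⟨fun i => L (fun j => if i = j then 1 else 0), ContinuousLinearMap.ext fun v => ?_⟩
    simpa [π, mul_comm] using LinearMap.pi_apply_eq_sum_univ (L : (ι → ℝ) →ₗ[ℝ] ℝ) v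
  have hint (ρ : Measure (ι → ℝ)) [IsGaussian ρ] (i : ι) : Integrable (fun v : ι → ℝ => v i) ρ :=
    IsGaussian.integrable_dual ρ (π i)
  have hcov (i j : ι) : covarianceBilinDual μ (π i) (π j) = covarianceBilinDual ν (π i) (π j) := by
    rw [covarianceBilinDual_eq_covariance IsGaussian.memLp_two_id,
      covarianceBilinDual_eq_covariance IsGaussian.memLp_two_id]
    exact hc i j
  refine IsGaussian.ext_covarianceBilinDual (funext fun i => ?_) ?_
  · exact (eval_integral (hint μ) i).trans ((hm i).trans (eval_integral (hint ν) i).symm)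
  · ext L L'
    obtain ⟨c, rfl⟩ := hexp L
    obtain ⟨c', rfl⟩ := hexp L'
    simp only [map_sum, map_smul, sum_apply, smul_apply, hcov]

variable [Fintype ι]

theorem pi_gaussianReal_eq_withDensity (m : ι → ℝ) {v : ι → ℝ≥0} (hv : ∀ i, v i ≠ 0) :
    Measure.pi (fun i => gaussianReal (m i) (v i)) =
      volume.withDensity fun y => ENNReal.ofReal (∏ i, gaussianPDFReal (m i) (v i) (y i)) := by
  refine Measure.pi_eq fun s hs => ?_
  rw [withDensity_apply _ (MeasurableSet.univ_pi hs), volume_pi, Measure.restrict_pi_pi,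
    ← ofReal_integral_eq_lintegral_ofReal, integral_fintype_prod_eq_prod,
    ENNReal.ofReal_prod_of_nonneg]
  · exact Finset.prod_congr rfl fun i _ => (gaussianReal_apply_eq_integral _ (hv i) _).symm
  · exact fun i _ => integral_nonneg fun x => gaussianPDFReal_nonneg _ _ _
  · exact Integrable.fintype_prod fun i => (integrable_gaussianPDFReal _ _).restrict
  · exact Filter.Eventually.of_forall fun y =>
      Finset.prod_nonneg fun i _ => gaussianPDFReal_nonneg _ _ _

variable [DecidableEq ι]

theorem map_mulVec_withDensity {M : Matrix ι ι ℝ} (hM : M.det ≠ 0) {p : (ι → ℝ) → ℝ}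
    (hp : Measurable p) :
    (volume.withDensity fun y => ENNReal.ofReal (p y)).map (fun y => M.mulVec y) =
      volume.withDensity fun y => ENNReal.ofReal (|M.det⁻¹| * p (M⁻¹.mulVec y)) := by
  have hvol : (volume : Measure (ι → ℝ)).map (fun y => M.mulVec y) =
      ENNReal.ofReal |M.det⁻¹| • volume := Real.map_matrix_volume_pi_eq_smul_volume_pi hM
  have hinv (y : ι → ℝ) : M⁻¹.mulVec (M.mulVec y) = y := by
    rw [Matrix.mulVec_mulVec, Matrix.nonsing_inv_mul _ hM.isUnit, Matrix.one_mulVec]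
  refine Measure.ext_of_lintegral _ fun F hF => ?_
  simp_rw [ENNReal.ofReal_mul (abs_nonneg M.det⁻¹)]
  rw [lintegral_map hF (by fun_prop), lintegral_withDensity_eq_lintegral_mul _ (by fun_prop)
    (by fun_prop), lintegral_withDensity_eq_lintegral_mul _ (by fun_prop) hF]
  simp only [Pi.mul_apply, mul_assoc]
  rw [lintegral_const_mul _ (by fun_prop), ← smul_eq_mul, ← lintegral_smul_measure, ← hvol,
    lintegral_map (by fun_prop) (by fun_prop)]
  simp_rw [hinv]

/-- The density of the centered Gaussian law on `ι → ℝ` with covariance matrix `S`, for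
nondegenerate `S`. -/
def gaussianDensity (S : Matrix ι ι ℝ) (y : ι → ℝ) : ℝ :=
  (√((2 * Real.pi) ^ Fintype.card ι * S.det))⁻¹ * Real.exp (-(y ⬝ᵥ S⁻¹.mulVec y) / 2)

theorem gaussianDensity_pos {S : Matrix ι ι ℝ} (hS : 0 < S.det) (y : ι → ℝ) :
    0 < gaussianDensity S y := by
  unfold gaussianDensity
  positivity

theorem measurable_gaussianDensity (S : Matrix ι ι ℝ) : Measurable (gaussianDensity S) := by
  unfold gaussianDensity
  simp only [dotProduct]
  fun_prop

theorem log_gaussianDensity {S : Matrix ι ι ℝ} (hS : 0 < S.det) (y : ι → ℝ) :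
    Real.log (gaussianDensity S y) =
      -(Fintype.card ι * Real.log (2 * Real.pi) + Real.log S.det) / 2
        - (y ⬝ᵥ S⁻¹.mulVec y) / 2 := by
  rw [gaussianDensity, Real.log_mul (by positivity) (by positivity), Real.log_exp, Real.log_inv,
    Real.log_sqrt (by positivity), Real.log_mul (by positivity) hS.ne', Real.log_pow]
  ring

theorem prod_gaussianPDFReal_zero_one (y : ι → ℝ) :
    ∏ i, gaussianPDFReal 0 1 (y i) = gaussianDensity 1 y := by
  simp only [gaussianPDFReal, Finset.prod_mul_distrib, ← Real.exp_sum, gaussianDensity]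
  congr 1
  · simp [Real.sqrt_eq_rpow, Real.rpow_pow_comm Real.two_pi_pos.le]
  · simp only [sub_zero, NNReal.coe_one, mul_one, pow_two, neg_div, Finset.sum_neg_distrib,
      ← Finset.sum_div, inv_one, Matrix.one_mulVec, dotProduct]

theorem abs_det_inv_mul_gaussianDensity_one (M : Matrix ι ι ℝ) (y : ι → ℝ) :
    |M.det⁻¹| * gaussianDensity 1 (M⁻¹.mulVec y) = gaussianDensity (M * M.transpose) y := by
  have hquad : M⁻¹.mulVec y ⬝ᵥ M⁻¹.mulVec y = y ⬝ᵥ (M * M.transpose)⁻¹.mulVec y := by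
    rw [Matrix.mul_inv_rev, ← Matrix.mulVec_mulVec, Matrix.dotProduct_mulVec y,
      ← Matrix.mulVec_transpose, Matrix.transpose_nonsing_inv, Matrix.transpose_transpose]
  simp only [gaussianDensity, inv_one, Matrix.one_mulVec, hquad, Matrix.det_one, mul_one,
    Matrix.det_mul, Matrix.det_transpose]
  rw [Real.sqrt_mul (by positivity), Real.sqrt_mul_self_eq_abs, mul_inv, abs_inv]
  ring

open scoped MatrixOrder in
theorem gpLaw_eq_map_pi (S : Matrix ι ι ℝ) :
    gpLaw (fun i j => S i j) = (Measure.pi fun _ : ι => gaussianReal 0 1).map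
      (fun y => (CFC.sqrt S).mulVec y) := by
  rw [gpLaw, multivariateGaussian, ← map_pi_eq_stdGaussian, Measure.map_map (by fun_prop)
    (by fun_prop), Measure.map_map (by fun_prop) (by fun_prop)]
  congr 1
  funext y i
  simp
  rfl

open scoped MatrixOrder in
theorem gpLaw_eq_withDensity {S : Matrix ι ι ℝ} (hS : S.PosDef) :
    gpLaw (fun i j => S i j) =
      volume.withDensity fun y => ENNReal.ofReal (gaussianDensity S y) := by
  set M := CFC.sqrt S with hM
  have hMT : M.transpose = M := by
    simpa using (Matrix.nonneg_iff_posSemidef.1 (CFC.sqrt_nonneg S)).isHermitian.eq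
  have hMM : M * M.transpose = S := by
    rw [hMT, hM, CFC.sqrt_mul_sqrt_self S hS.posSemidef.nonneg]
  have hdet : M.det ≠ 0 := fun h => hS.det_pos.ne' (by rw [← hMM, Matrix.det_mul, h, zero_mul])
  rw [gpLaw_eq_map_pi, pi_gaussianReal_eq_withDensity _ fun _ => one_ne_zero]
  simp_rw [prod_gaussianPDFReal_zero_one]
  rw [map_mulVec_withDensity hdet (measurable_gaussianDensity 1)]
  simp_rw [abs_det_inv_mul_gaussianDensity_one, hMM]

variable {Ω : Type*} [MeasurableSpace Ω] {P : Measure Ω} {Y : Ω → ι → ℝ}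

theorem map_eq_gpLaw {S : Matrix ι ι ℝ} (hS : S.PosSemidef) (hY : HasGaussianLaw Y P)
    (hmean : ∀ i, ∫ ω, Y ω i ∂P = 0)
    (hcov : ∀ i j, cov[fun ω => Y ω i, fun ω => Y ω j; P] = S i j) :
    P.map Y = gpLaw fun i j => S i j := by
  have hm := hY.aemeasurable
  have := hY.isGaussian_map
  refine isGaussian_ext_pi (fun i => ?_) fun i j => ?_
  · rw [integral_gpLaw, integral_map (f := fun v : ι → ℝ => v i) hm
      (measurable_pi_apply i).aestronglyMeasurable, hmean]
  · rw [covariance_gpLaw hS, covariance_map_fun (measurable_pi_apply i).aestronglyMeasurable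
      (measurable_pi_apply j).aestronglyMeasurable hm, hcov]

theorem integrable_log_gaussianDensity [IsFiniteMeasure P] {S : Matrix ι ι ℝ} (hS : 0 < S.det)
    (hY : ∀ i, MemLp (fun ω => Y ω i) 2 P) :
    Integrable (fun ω => Real.log (gaussianDensity S (Y ω))) P := by
  simp_rw [log_gaussianDensity hS, dotProduct, Matrix.mulVec, dotProduct, Finset.mul_sum]
  exact (integrable_const _).sub <| Integrable.div_const (integrable_finsetSum _ fun i _ =>
    integrable_finsetSum _ fun j _ => (hY i).integrable_mul ((hY j).const_mul _)) _

/-- Minus the left-hand side is the differential entropy of `Y` when `Y` is Gaussian. -/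
theorem integral_log_gaussianDensity [IsProbabilityMeasure P] {S : Matrix ι ι ℝ} (hS : 0 < S.det)
    (hY : ∀ i, MemLp (fun ω => Y ω i) 2 P) (hYY : ∀ i j, ∫ ω, Y ω i * Y ω j ∂P = S i j) :
    ∫ ω, Real.log (gaussianDensity S (Y ω)) ∂P =
      -(Fintype.card ι * (Real.log (2 * Real.pi) + 1) + Real.log S.det) / 2 := by
  have hint (i j : ι) : Integrable (fun ω => Y ω i * (S⁻¹ i j * Y ω j)) P :=
    (hY i).integrable_mul ((hY j).const_mul _)
  have hterm (i j : ι) : ∫ ω, Y ω i * (S⁻¹ i j * Y ω j) ∂P = S⁻¹ i j * S j i := by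
    rw [← hYY, ← integral_const_mul]
    exact integral_congr_ae (.of_forall fun ω => by ring)
  have hquad : ∫ ω, Y ω ⬝ᵥ S⁻¹.mulVec (Y ω) ∂P = Fintype.card ι := by
    simp only [dotProduct, Matrix.mulVec, Finset.mul_sum]
    rw [integral_finsetSum _ fun i _ => integrable_finsetSum _ fun j _ => hint i j]
    simp_rw [integral_finsetSum _ fun j _ => hint _ j, hterm, ← Matrix.mul_apply,
      Matrix.nonsing_inv_mul _ hS.ne'.isUnit]
    simp
  have hquad_int : Integrable (fun ω => Y ω ⬝ᵥ S⁻¹.mulVec (Y ω)) P := by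
    simp only [dotProduct, Matrix.mulVec, Finset.mul_sum]
    exact integrable_finsetSum _ fun i _ => integrable_finsetSum _ fun j _ => hint i j
  simp_rw [log_gaussianDensity hS]
  rw [integral_sub (integrable_const _) (hquad_int.div_const _),
    integral_div _ fun ω => Y ω ⬝ᵥ S⁻¹.mulVec (Y ω), hquad, integral_const, probReal_univ, one_smul]
  ring

end Density

section AdditiveChannel

variable {Ω ι : Type*} [MeasurableSpace Ω] [Fintype ι] {P : Measure Ω} [IsProbabilityMeasure P]
  {F E : Ω → ι → ℝ} {φ q : (ι → ℝ) → ℝ}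

theorem map_add_prodMk_eq_withDensity (hF : Measurable F) (hE : Measurable E)
    (hind : IndepFun F E P) (hφ : Measurable φ)
    (hEφ : P.map E = volume.withDensity fun y => ENNReal.ofReal (φ y)) :
    P.map (fun ω => (F ω + E ω, F ω)) =
      (volume.prod (P.map F)).withDensity fun p => ENNReal.ofReal (φ (p.1 - p.2)) := by
  have := Measure.isProbabilityMeasure_map (μ := P) hF.aemeasurable
  have hjoint : P.map (fun ω => (F ω, E ω)) = (P.map F).prod (P.map E) :=
    (indepFun_iff_map_prod_eq_prod_map_map hF.aemeasurable hE.aemeasurable).1 hind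
  have hcomp : P.map (fun ω => (F ω + E ω, F ω)) =
      ((P.map F).prod (P.map E)).map fun p => (p.1 + p.2, p.1) := by
    rw [← hjoint, Measure.map_map (by fun_prop) (by fun_prop)]
    rfl
  have := Measure.isProbabilityMeasure_map (μ := P) hE.aemeasurable
  refine Measure.ext_of_lintegral _ fun G hG => ?_
  rw [hcomp, lintegral_map hG (by fun_prop), lintegral_prod _ (by fun_prop),
    lintegral_withDensity_eq_lintegral_mul _ (by fun_prop) hG,
    lintegral_prod_symm' _ (by fun_prop)]
  refine lintegral_congr fun z => ?_
  rw [hEφ, lintegral_withDensity_eq_lintegral_mul _ (by fun_prop) (by fun_prop)]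
  refine Eq.trans (lintegral_congr fun y => ?_) (lintegral_add_right_eq_self _ z)
  simp [add_comm y z]

theorem toReal_mutualInfo_add (hF : Measurable F) (hE : Measurable E) (hind : IndepFun F E P)
    (hφ : Measurable φ) (hφ_pos : ∀ y, 0 < φ y) (hq : Measurable q) (hq_pos : ∀ y, 0 < q y)
    (hEφ : P.map E = volume.withDensity fun y => ENNReal.ofReal (φ y))
    (hFEq : P.map (fun ω => F ω + E ω) = volume.withDensity fun y => ENNReal.ofReal (q y)) :
    (mutualInfo P (fun ω => F ω + E ω) F).toReal =
      ∫ ω, (Real.log (φ (E ω)) - Real.log (q (F ω + E ω))) ∂P := by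
  have := Measure.isProbabilityMeasure_map (μ := P) hF.aemeasurable
  have := Measure.isProbabilityMeasure_map (μ := P) (hF.add hE).aemeasurable
  have hpair : Measurable fun ω => (F ω + E ω, F ω) := (hF.add hE).prodMk hF
  have := Measure.isProbabilityMeasure_map (μ := P) hpair.aemeasurable
  set J := P.map fun ω => (F ω + E ω, F ω)
  set R := (P.map fun ω => F ω + E ω).prod (P.map F)
  set d : (ι → ℝ) × (ι → ℝ) → ℝ≥0∞ := fun p => ENNReal.ofReal (φ (p.1 - p.2) / q p.1) with hd
  have hdm : Measurable d := by fun_prop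
  have hR : R = (volume.prod (P.map F)).withDensity fun p => ENNReal.ofReal (q p.1) := by
    rw [show R = (P.map fun ω => F ω + E ω).prod (P.map F) from rfl, hFEq,
      prod_withDensity_left (by fun_prop)]
  have hJR : J = R.withDensity d := by
    rw [hR, ← withDensity_mul _ (by fun_prop) hdm]
    refine (map_add_prodMk_eq_withDensity hF hE hind hφ hEφ).trans ?_
    congr 1
    funext p
    rw [Pi.mul_apply, hd, ← ENNReal.ofReal_mul (hq_pos _).le, mul_div_cancel₀ _ (hq_pos _).ne']
  have hac : J ≪ R := hJR ▸ withDensity_absolutelyContinuous _ _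
  have hrn : J.rnDeriv R =ᵐ[R] d := hJR ▸ Measure.rnDeriv_withDensity _ hdm
  have hllr : llr J R =ᵐ[J] fun p => Real.log (φ (p.1 - p.2)) - Real.log (q p.1) := by
    filter_upwards [hac.ae_eq hrn] with p hp
    rw [llr, hp, hd, ENNReal.toReal_ofReal (div_nonneg (hφ_pos _).le (hq_pos _).le),
      Real.log_div (hφ_pos _).ne' (hq_pos _).ne']
  have hlog : Measurable fun p : (ι → ℝ) × (ι → ℝ) =>
      Real.log (φ (p.1 - p.2)) - Real.log (q p.1) := by fun_prop
  rw [mutualInfo, InformationTheory.toReal_klDiv_of_measure_eq hac (by simp),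
    integral_congr_ae hllr, integral_map hpair.aemeasurable hlog.aestronglyMeasurable]
  simp

end AdditiveChannel

section InfoGain

variable {Ω X ι : Type*} [MeasurableSpace Ω] [Fintype X] [DecidableEq X]
  [DecidableEq ι] {P : Measure Ω} {σn : ℝ} {k : X → X → ℝ} {f : Ω → X → ℝ} {e : Ω → ι → ℝ}

theorem posDef_sq_smul_one (hσn : 0 < σn) : (σn ^ 2 • (1 : Matrix ι ι ℝ)).PosDef :=
  Matrix.PosDef.one.smul (by positivity)

theorem IsGPModel.integral_e_mul_e (h : IsGPModel P σn k f e) (i j : ι) :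
    ∫ ω, e ω i * e ω j ∂P = (σn ^ 2 • (1 : Matrix ι ι ℝ)) i j := by
  have := h.isProbabilityMeasure
  have hcov := covariance_eq_sub (h.memLp_e i) (h.memLp_e j)
  rw [h.covariance_e, h.integral_e, zero_mul, sub_zero] at hcov
  simpa [Matrix.one_apply] using hcov.symm

variable [Fintype ι]

theorem IsGPModel.map_e (h : IsGPModel P σn k f e) (hσn : 0 < σn) :
    P.map e = gpLaw fun i j => (σn ^ 2 • (1 : Matrix ι ι ℝ)) i j :=
  map_eq_gpLaw (posDef_sq_smul_one hσn).posSemidef h.hasGaussianLaw_e h.integral_e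
    fun i j => by simp [h.covariance_e, Matrix.one_apply]

theorem IsGPModel.map_observe (h : IsGPModel P σn k f e) (hk : (Matrix.of k).PosSemidef)
    (hσn : 0 < σn) (A : ι → X) :
    P.map (fun ω => observe A (f ω) (e ω)) =
      gpLaw fun i j => gram σn k A i j :=
  map_eq_gpLaw (posDef_gram hk hσn A).posSemidef (h.hasGaussianLaw_residual_observe hk A).snd
    (h.integral_observe A) (h.covariance_observe hk A)

theorem infoGain_eq (hk : (Matrix.of k).PosSemidef) (hσn : 0 < σn) {n : ℕ} (A : Fin n → X) :
    infoGain σn k A = Real.log (gram σn k A).det / 2 - n * Real.log σn := by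
  have h : IsGPModel ((gpLaw k).prod (Measure.pi fun _ : Fin n => noiseLaw σn)) σn k
    Prod.fst Prod.snd := isGPModel_prod
  have hG := posDef_gram hk hσn A
  have hN := posDef_sq_smul_one (ι := Fin n) hσn
  have hres : Measurable fun v : X → ℝ => fun j => v (A j) := by fun_prop
  have hinfo := toReal_mutualInfo_add (hres.comp measurable_fst) measurable_snd
    (h.indep.comp hres measurable_id) (measurable_gaussianDensity _)
    (gaussianDensity_pos hN.det_pos) (measurable_gaussianDensity _)
    (gaussianDensity_pos hG.det_pos) ((h.map_e hσn).trans (gpLaw_eq_withDensity hN))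
    ((h.map_observe hk hσn A).trans (gpLaw_eq_withDensity hG))
  refine (hinfo.trans (integral_sub (integrable_log_gaussianDensity hN.det_pos h.memLp_e)
    (integrable_log_gaussianDensity hG.det_pos (h.memLp_observe A)))).trans ?_
  refine (congrArg₂ (· - ·) (integral_log_gaussianDensity hN.det_pos h.memLp_e h.integral_e_mul_e)
    (integral_log_gaussianDensity hG.det_pos (h.memLp_observe A)
      (h.integral_observe_mul_observe hk A))).trans ?_
  rw [Matrix.det_smul, Matrix.det_one, mul_one, ← pow_mul, Real.log_pow]
  push_cast [Fintype.card_fin]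
  ring

end InfoGain

/-! ### Conditional laws on an event -/

section DependsOnlyOn

variable {Ω 𝓩 𝓨 𝒲 : Type*} [MeasurableSpace Ω] [MeasurableSpace 𝓩] [MeasurableSpace 𝓨]
  [MeasurableSpace 𝒲]

/-- On the event `E`, the conditional (sub-probability) law of `W` given `Z` depends on `Z` only
through `obs Z`. The algorithm's data satisfy this with `Z` the unknown function and the noise, and
`obs Z` the observations at a fixed design, on the event that the algorithm chose this design. -/
def DependsOnlyOn (P : Measure Ω) (Z : Ω → 𝓩) (obs : 𝓩 → 𝓨) (W : Ω → 𝒲) (E : Set Ω) : Prop :=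
  ∃ κ : Kernel 𝓨 𝒲, IsSFiniteKernel κ ∧ ∀ F : 𝓩 × 𝒲 → ℝ≥0∞, Measurable F →
    ∫⁻ ω in E, F (Z ω, W ω) ∂P = ∫⁻ ω, ∫⁻ w, F (Z ω, w) ∂κ (obs (Z ω)) ∂P

namespace DependsOnlyOn

variable {P : Measure Ω} {Z : Ω → 𝓩} {obs : 𝓩 → 𝓨} {W : Ω → 𝒲} {E : Set Ω}

theorem of_indepFun [IsProbabilityMeasure P] (hZ : Measurable Z) (hW : Measurable W)
    (h : IndepFun Z W P) (obs : 𝓩 → 𝓨) : DependsOnlyOn P Z obs W Set.univ := by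
  have := Measure.isProbabilityMeasure_map (μ := P) hW.aemeasurable
  refine ⟨Kernel.const _ (P.map W), inferInstance, fun F hF => ?_⟩
  rw [Measure.restrict_univ, ← lintegral_map (f := F) (g := fun ω => (Z ω, W ω)) hF (hZ.prodMk hW),
    (indepFun_iff_map_prod_eq_prod_map_map hZ.aemeasurable hW.aemeasurable).1 h,
    lintegral_prod _ hF.aemeasurable, lintegral_map hF.lintegral_prod_right' hZ]
  rfl

theorem of_comp {𝓨' : Type*} [MeasurableSpace 𝓨'] {obs' : 𝓩 → 𝓨'} {c : 𝓨' → 𝓨}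
    (h : DependsOnlyOn P Z (c ∘ obs') W E) (hc : Measurable c) : DependsOnlyOn P Z obs' W E := by
  obtain ⟨κ, hκ, h⟩ := h
  exact ⟨κ.comap c hc, inferInstance, h⟩

theorem inter (h : DependsOnlyOn P Z obs W E) (hZ : Measurable Z) (hobs : Measurable obs)
    (hW : Measurable W) {T : Set (𝓨 × 𝒲)} (hT : MeasurableSet T) :
    DependsOnlyOn P Z obs W (E ∩ {ω | (obs (Z ω), W ω) ∈ T}) := by
  obtain ⟨κ, hκ, h⟩ := h
  have hTm : MeasurableSet {ω | (obs (Z ω), W ω) ∈ T} := ((hobs.comp hZ).prodMk hW) hT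
  let d : 𝓨 → 𝒲 → ℝ≥0∞ := fun y w => T.indicator 1 (y, w)
  have hd : Measurable (Function.uncurry d) := measurable_one.indicator hT
  have hd_ne_top (y : 𝓨) (w : 𝒲) : d y w ≠ ∞ := by by_cases hyw : (y, w) ∈ T <;> simp [d, hyw]
  refine ⟨κ.withDensity d, Kernel.IsSFiniteKernel.withDensity κ hd_ne_top, fun F hF => ?_⟩
  calc ∫⁻ ω in E ∩ {ω | (obs (Z ω), W ω) ∈ T}, F (Z ω, W ω) ∂P
    _ = ∫⁻ ω in E, d (obs (Z ω)) (W ω) * F (Z ω, W ω) ∂P := by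
      rw [Set.inter_comm, ← Measure.restrict_restrict hTm, ← lintegral_indicator hTm]
      refine lintegral_congr fun ω => ?_
      by_cases hω : (obs (Z ω), W ω) ∈ T <;> simp [d, hω]
    _ = ∫⁻ ω, ∫⁻ w, d (obs (Z ω)) w * F (Z ω, w) ∂κ (obs (Z ω)) ∂P :=
      h (fun p => d (obs p.1) p.2 * F p)
        ((hd.comp ((hobs.comp measurable_fst).prodMk measurable_snd)).mul hF)
    _ = ∫⁻ ω, ∫⁻ w, F (Z ω, w) ∂κ.withDensity d (obs (Z ω)) ∂P :=
      lintegral_congr fun ω =>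
        (Kernel.lintegral_withDensity κ hd _ (hF.comp measurable_prodMk_left)).symm

theorem prodMk {𝒢 : Type*} [MeasurableSpace 𝒢] (h : DependsOnlyOn P Z obs W E)
    (hobs : Measurable obs) {G : Ω → 𝒢} (η : Kernel 𝓨 𝒢) [IsSFiniteKernel η]
    (hG : ∀ Φ : (𝓩 × 𝒲) × 𝒢 → ℝ≥0∞, Measurable Φ →
      ∫⁻ ω in E, Φ ((Z ω, W ω), G ω) ∂P =
        ∫⁻ ω in E, ∫⁻ w, Φ ((Z ω, W ω), w) ∂η (obs (Z ω)) ∂P) :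
    DependsOnlyOn P Z obs (fun ω => (W ω, G ω)) E := by
  obtain ⟨κ, hκ, h⟩ := h
  refine ⟨κ ⊗ₖ η.comap Prod.fst measurable_fst, inferInstance, fun F hF => ?_⟩
  have hF' : Measurable fun p : (𝓩 × 𝒲) × 𝒢 => F (p.1.1, p.1.2, p.2) := by fun_prop
  calc ∫⁻ ω in E, F (Z ω, W ω, G ω) ∂P
    _ = ∫⁻ ω in E, ∫⁻ w, F (Z ω, W ω, w) ∂η (obs (Z ω)) ∂P := hG _ hF'
    _ = ∫⁻ ω, ∫⁻ w, ∫⁻ w', F (Z ω, w, w') ∂η (obs (Z ω)) ∂κ (obs (Z ω)) ∂P :=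
      h (fun p => ∫⁻ w', F (p.1, p.2, w') ∂η (obs p.1)) <|
        hF'.lintegral_kernel_prod_right'
          (κ := η.comap (fun p : 𝓩 × 𝒲 => obs p.1) (hobs.comp measurable_fst))
    _ = ∫⁻ ω, ∫⁻ w, F (Z ω, w) ∂(κ ⊗ₖ η.comap Prod.fst measurable_fst) (obs (Z ω)) ∂P :=
      lintegral_congr fun ω =>
        (Kernel.lintegral_compProd κ (η.comap Prod.fst measurable_fst) (obs (Z ω))
          (hF.comp measurable_prodMk_left)).symm

theorem comp {𝒲' : Type*} [MeasurableSpace 𝒲'] (h : DependsOnlyOn P Z obs W E) {c : 𝒲 → 𝒲'}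
    (hc : Measurable c) : DependsOnlyOn P Z obs (c ∘ W) E := by
  obtain ⟨κ, hκ, h⟩ := h
  refine ⟨κ.map c, inferInstance, fun F hF => ?_⟩
  refine (h (fun p => F (p.1, c p.2)) (by fun_prop)).trans (lintegral_congr fun ω => ?_)
  exact (Kernel.lintegral_map κ hc (obs (Z ω)) (hF.comp measurable_prodMk_left)).symm

theorem restrict_map {R : Type*} [MeasurableSpace R] {r : 𝓩 → R}
    (h : DependsOnlyOn P Z obs W E) (hZ : Measurable Z) (hobs : Measurable obs)
    (hr : Measurable r) (hind : IndepFun (r ∘ Z) (obs ∘ Z) P) :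
    (P.restrict E).map (r ∘ Z) = P E • P.map (r ∘ Z) := by
  obtain ⟨κ, -, h⟩ := h
  have hrZ : Measurable (r ∘ Z) := hr.comp hZ
  have hκ_univ : Measurable fun y => κ y Set.univ := κ.measurable_coe MeasurableSet.univ
  refine Measure.ext_of_lintegral _ fun F hF => ?_
  rw [lintegral_map hF hrZ, lintegral_smul_measure, lintegral_map hF hrZ]
  calc ∫⁻ ω in E, F (r (Z ω)) ∂P
    _ = ∫⁻ ω, F (r (Z ω)) * κ (obs (Z ω)) Set.univ ∂P := by
      simpa using h (fun p => F (r p.1)) (by fun_prop)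
    _ = (∫⁻ ω, F (r (Z ω)) ∂P) * ∫⁻ ω, κ (obs (Z ω)) Set.univ ∂P :=
      lintegral_mul_eq_lintegral_mul_lintegral_of_indepFun (hF.comp hrZ)
        (hκ_univ.comp (hobs.comp hZ)) (hind.comp hF hκ_univ)
    _ = P E • ∫⁻ ω, F (r (Z ω)) ∂P := by
      rw [smul_eq_mul, mul_comm]
      congr 1
      simpa using (h 1 measurable_one).symm

end DependsOnlyOn

end DependsOnlyOn

section IIDKernel

variable {α β ι : Type*} [MeasurableSpace α] [MeasurableSpace β] [Fintype ι] (κ : Kernel α β)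
  [IsMarkovKernel κ]

variable (ι) in
/-- The kernel of i.i.d. draws, indexed by `ι`, from a Markov kernel. -/
def iidKernel : Kernel α (ι → β) where
  toFun a := Measure.pi fun _ => κ a
  measurable' := by
    refine Measurable.measure_of_isPiSystem_of_isProbabilityMeasure generateFrom_pi.symm
      isPiSystem_pi ?_
    rintro _ ⟨s, hs, rfl⟩
    simp_rw [Measure.pi_pi]
    exact Finset.measurable_fun_prod _ fun i _ => κ.measurable_coe (hs i (Set.mem_univ i))

instance : IsMarkovKernel (iidKernel ι κ) :=
  ⟨fun a => inferInstanceAs (IsProbabilityMeasure (Measure.pi fun _ => κ a))⟩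

theorem lintegral_iidKernel_eval (a : α) (i : ι) {F : β → ℝ≥0∞} (hF : Measurable F) :
    ∫⁻ w, F (w i) ∂iidKernel ι κ a = ∫⁻ v, F v ∂κ a :=
  (measurePreserving_eval (fun _ : ι => κ a) i).lintegral_comp hF

end IIDKernel

/-! ### Conditional laws along a run -/

section Data

variable {Ω X 𝒰 : Type*} {m t : ℕ}

/-- What the algorithm does not control: the unknown function together with the noise. -/
def env (f : Ω → X → ℝ) (ε : Ω → ℕ → Fin m → ℝ) (ω : Ω) : (X → ℝ) × (ℕ → Fin m → ℝ) :=
  (f ω, ε ω)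

/-- The internal randomness of the algorithm before round `t`: the tie-breaking randomness together
with the draws of the earlier rounds. -/
def internal (U : Ω → 𝒰) (g : ℕ → Ω → Fin m → X → ℝ) (t : ℕ) (ω : Ω) :
    𝒰 × (Fin t → Fin m → X → ℝ) :=
  (U ω, fun s => g s ω)

/-- The values observed at the design `A` when the unknown function and the noise are given by
`v`. -/
def obsAt (A : Fin t × Fin m → X) (v : (X → ℝ) × (ℕ → Fin m → ℝ)) : Fin t × Fin m → ℝ :=
  observe A v.1 fun p => v.2 p.1 p.2

/-- The design `A` of the first `t` rounds, followed by the batch `b`. -/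
def appendRound (A : Fin t × Fin m → X) (b : Fin m → X) : Fin (t + 1) × Fin m → X :=
  fun p => (Fin.snoc (fun s i => A (s, i)) b : Fin (t + 1) → Fin m → X) p.1 p.2

variable {f : Ω → X → ℝ} {ε : Ω → ℕ → Fin m → ℝ} {x : ℕ → Ω → Fin m → X}

theorem history_eq (ω : Ω) :
    history f ε x t ω = (design x t ω, obsAt (design x t ω) (env f ε ω)) :=
  rfl

theorem history_eq_of_design_eq {A : Fin t × Fin m → X} {ω : Ω} (hω : design x t ω = A) :
    history f ε x t ω = (A, obsAt A (env f ε ω)) := by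
  rw [history_eq, hω]

@[simp]
theorem appendRound_castSucc (A : Fin t × Fin m → X) (b : Fin m → X) (s : Fin t) (i : Fin m) :
    appendRound A b (s.castSucc, i) = A (s, i) := by
  simp [appendRound]

@[simp]
theorem appendRound_last (A : Fin t × Fin m → X) (b : Fin m → X) (i : Fin m) :
    appendRound A b (Fin.last t, i) = b i := by
  simp [appendRound]

theorem appendRound_castSucc_last (A : Fin (t + 1) × Fin m → X) :
    appendRound (fun p => A (p.1.castSucc, p.2)) (fun i => A (Fin.last t, i)) = A := by
  ext ⟨s, i⟩
  cases s using Fin.lastCases <;> simp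

theorem appendRound_inj {A A' : Fin t × Fin m → X} {b b' : Fin m → X} :
    appendRound A b = appendRound A' b' ↔ A = A' ∧ b = b' := by
  refine ⟨fun h => ⟨funext fun p => ?_, funext fun i => ?_⟩, fun h => by rw [h.1, h.2]⟩
  · simpa using congrFun h (p.1.castSucc, p.2)
  · simpa using congrFun h (Fin.last t, i)

theorem design_succ (t : ℕ) (ω : Ω) :
    design x (t + 1) ω = appendRound (design x t ω) (x t ω) :=
  (appendRound_castSucc_last _).symm

theorem design_succ_eq_appendRound_iff {A : Fin t × Fin m → X} {b : Fin m → X} {ω : Ω} :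
    design x (t + 1) ω = appendRound A b ↔ design x t ω = A ∧ x t ω = b := by
  rw [design_succ, appendRound_inj]

@[fun_prop]
theorem measurable_obsAt_apply (A : Fin t × Fin m → X) : Measurable (obsAt A) := by
  unfold obsAt observe
  fun_prop

variable [MeasurableSpace X]

theorem measurable_obsAt [Countable X] [MeasurableSingletonClass X] :
    Measurable fun p : (Fin t × Fin m → X) × ((X → ℝ) × (ℕ → Fin m → ℝ)) => obsAt p.1 p.2 := by
  have h_eval : Measurable fun p : (X → ℝ) × X => p.1 p.2 :=
    measurable_from_prod_countable_left fun z => measurable_pi_apply z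
  refine measurable_pi_iff.2 fun q => Measurable.add ?_ (by fun_prop)
  exact h_eval.comp (by fun_prop : Measurable fun p :
    (Fin t × Fin m → X) × ((X → ℝ) × (ℕ → Fin m → ℝ)) => (p.2.1, p.1 q))

theorem measurable_appendRound :
    Measurable fun p : (Fin t × Fin m → X) × (Fin m → X) => appendRound p.1 p.2 := by
  refine measurable_pi_iff.2 fun ⟨s, i⟩ => ?_
  cases s using Fin.lastCases with
  | last => simpa only [appendRound_last] using by fun_prop
  | cast s => simpa only [appendRound_castSucc] using by fun_prop

end Data

namespace IsRun

variable {Ω X 𝒰 : Type*} [MeasurableSpace Ω] [Fintype X] [DecidableEq X] [MeasurableSpace X]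
  [MeasurableSpace 𝒰] {P : Measure Ω} [IsProbabilityMeasure P]
  {σn : ℝ} {k : X → X → ℝ} {m : ℕ} {f : Ω → X → ℝ} {ε : Ω → ℕ → Fin m → ℝ} {U : Ω → 𝒰}
  {g : ℕ → Ω → Fin m → X → ℝ} {x : ℕ → Ω → Fin m → X}

theorem measurable_env (h : IsRun P σn k m f ε U g x) : Measurable (env f ε) :=
  h.measurable_f.prodMk h.measurable_ε

theorem measurable_internal (h : IsRun P σn k m f ε U g x) (t : ℕ) :
    Measurable (internal U g t) :=
  h.measurable_U.prodMk (measurable_pi_iff.2 fun s => h.measurable_g s)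

theorem isGPModel (h : IsRun P σn k m f ε U g x) (t : ℕ) :
    IsGPModel P σn k f (fun ω (p : Fin t × Fin m) => ε ω p.1 p.2) where
  measurable_f := h.measurable_f
  measurable_e := by have := h.measurable_ε; fun_prop
  law_f := h.law_f
  law_e p := h.law_ε p.1 p.2
  indep_e := h.indep_ε.precomp (g := Prod.map Fin.val id)
    (Fin.val_injective.prodMap Function.injective_id)
  indep := h.indep_f_ε.comp (ψ := fun (e : ℕ → Fin m → ℝ) (p : Fin t × Fin m) => e p.1 p.2)
    measurable_id (by fun_prop)

theorem lintegral_draw (h : IsRun P σn k m f ε U g x) (t : ℕ)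
    {Φ : (((X → ℝ) × (ℕ → Fin m → ℝ)) × 𝒰 × (Fin t → Fin m → X → ℝ)) × (Fin m → X → ℝ) → ℝ≥0∞}
    (hΦ : Measurable Φ) :
    ∫⁻ ω, Φ ((env f ε ω, internal U g t ω), g t ω) ∂P =
      ∫⁻ ω, ∫⁻ w, Φ ((env f ε ω, internal U g t ω), w)
        ∂iidKernel (Fin m) (condDistrib f (history f ε x t) P) (history f ε x t ω) ∂P := by
  let V : Ω → (X → ℝ) × (ℕ → Fin m → ℝ) × 𝒰 × (Fin t → Fin m → X → ℝ) :=
    fun ω => (f ω, ε ω, U ω, fun s => g s ω)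
  have hV : Measurable V := h.measurable_f.prodMk (h.measurable_ε.prodMk (h.measurable_internal t))
  let Ψ : ((X → ℝ) × (ℕ → Fin m → ℝ) × 𝒰 × (Fin t → Fin m → X → ℝ)) × (Fin m → X → ℝ) → ℝ≥0∞ :=
    fun p => Φ (((p.1.1, p.1.2.1), p.1.2.2), p.2)
  have hΨ : Measurable Ψ := by fun_prop
  calc ∫⁻ ω, Ψ (V ω, g t ω) ∂P
    _ = ∫⁻ p, Ψ p ∂P.map V ⊗ₘ condDistrib (g t) V P := by
      rw [compProd_map_condDistrib (h.measurable_g t).aemeasurable,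
        lintegral_map hΨ (hV.prodMk (h.measurable_g t))]
    _ = ∫⁻ ω, ∫⁻ w, Ψ (V ω, w) ∂condDistrib (g t) V P (V ω) ∂P := by
      rw [Measure.lintegral_compProd hΨ, lintegral_map hΨ.lintegral_kernel_prod_right' hV]
    _ = ∫⁻ ω, ∫⁻ w, Ψ (V ω, w) ∂iidKernel (Fin m) (condDistrib f (history f ε x t) P)
          (history f ε x t ω) ∂P := by
      refine lintegral_congr_ae ((h.draws t).mono fun ω hω => ?_)
      simp only [V, hω]
      rfl

theorem exists_design_eq [MeasurableSingletonClass X] (h : IsRun P σn k m f ε U g x) (t : ℕ) :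
    ∃ δ : ((X → ℝ) × (ℕ → Fin m → ℝ)) × 𝒰 × (Fin t → Fin m → X → ℝ) → Fin t × Fin m → X,
      Measurable δ ∧ ∀ ω, design x t ω = δ (env f ε ω, internal U g t ω) := by
  induction t with
  | zero =>
    exact ⟨fun _ p => p.1.elim0, measurable_pi_iff.2 fun p => p.1.elim0,
      fun ω => funext fun p => p.1.elim0⟩
  | succ t ih =>
    obtain ⟨δ, hδ, hδ_eq⟩ := ih
    obtain ⟨φ, hφ, hφ_eq⟩ := h.nonanticipating t
    let δ₀ : ((X → ℝ) × (ℕ → Fin m → ℝ)) × 𝒰 × (Fin (t + 1) → Fin m → X → ℝ) →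
        Fin t × Fin m → X := fun v => δ (v.1, v.2.1, fun s => v.2.2 s.castSucc)
    have hδ₀ : Measurable δ₀ := by fun_prop
    have hδ₀_eq (ω : Ω) : δ₀ (env f ε ω, internal U g (t + 1) ω) = design x t ω := (hδ_eq ω).symm
    refine ⟨fun v => appendRound (δ₀ v) (φ (v.2.1, (δ₀ v, obsAt (δ₀ v) v.1), v.2.2)),
      measurable_appendRound.comp (hδ₀.prodMk (hφ.comp ?_)), fun ω => ?_⟩
    · exact measurable_snd.fst.prodMk ((hδ₀.prodMk
        (measurable_obsAt.comp (hδ₀.prodMk measurable_fst))).prodMk measurable_snd.snd)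
    · simp only [design_succ, hφ_eq, hδ₀_eq]
      rfl

section MeasurableSingletonClass

variable [MeasurableSingletonClass X]

theorem measurable_design (h : IsRun P σn k m f ε U g x) (t : ℕ) : Measurable (design x t) := by
  obtain ⟨δ, hδ, hδ_eq⟩ := h.exists_design_eq t
  rw [funext hδ_eq]
  exact hδ.comp (h.measurable_env.prodMk (h.measurable_internal t))

theorem measurable_history (h : IsRun P σn k m f ε U g x) (t : ℕ) :
    Measurable (history f ε x t) :=
  (h.measurable_design t).prodMk
    (measurable_obsAt.comp ((h.measurable_design t).prodMk h.measurable_env))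

theorem measurable_x (h : IsRun P σn k m f ε U g x) (t : ℕ) : Measurable (x t) := by
  have hx : x t = fun ω i => design x (t + 1) ω (Fin.last t, i) := by
    simp only [design_succ, appendRound_last]
  rw [hx]
  have := h.measurable_design (t + 1)
  fun_prop

theorem measurableSet_design_eq (h : IsRun P σn k m f ε U g x) {t : ℕ} (A : Fin t × Fin m → X) :
    MeasurableSet {ω | design x t ω = A} :=
  measurableSet_eq_fun (h.measurable_design t) measurable_const

theorem map_history_draw (h : IsRun P σn k m f ε U g x) (t : ℕ) (i : Fin m) :
    P.map (fun ω => (history f ε x t ω, g t ω i)) = P.map (fun ω => (history f ε x t ω, f ω)) := by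
  have h_hist := h.measurable_history t
  have h_draw : Measurable fun ω => g t ω i := (measurable_pi_apply i).comp (h.measurable_g t)
  obtain ⟨δ, hδ, hδ_eq⟩ := h.exists_design_eq t
  refine Measure.ext_of_lintegral _ fun F hF => ?_
  have hΦ : Measurable fun p : (((X → ℝ) × (ℕ → Fin m → ℝ)) × 𝒰 × (Fin t → Fin m → X → ℝ)) ×
      (Fin m → X → ℝ) => F ((δ p.1, obsAt (δ p.1) p.1.1), p.2 i) := by
    have h_obs := measurable_obsAt.comp (hδ.prodMk measurable_fst)
    exact hF.comp (((hδ.prodMk h_obs).comp measurable_fst).prodMk (by fun_prop))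
  calc ∫⁻ p, F p ∂P.map (fun ω => (history f ε x t ω, g t ω i))
    _ = ∫⁻ ω, F (history f ε x t ω, g t ω i) ∂P := lintegral_map hF (h_hist.prodMk h_draw)
    _ = ∫⁻ ω, ∫⁻ w, F (history f ε x t ω, w i)
          ∂iidKernel (Fin m) (condDistrib f (history f ε x t) P) (history f ε x t ω) ∂P := by
      simpa only [← hδ_eq, ← history_eq] using h.lintegral_draw t hΦ
    _ = ∫⁻ ω, ∫⁻ v, F (history f ε x t ω, v)
          ∂condDistrib f (history f ε x t) P (history f ε x t ω) ∂P :=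
      lintegral_congr fun ω => lintegral_iidKernel_eval _ _ i (hF.comp measurable_prodMk_left)
    _ = ∫⁻ p, F p ∂P.map (fun ω => (history f ε x t ω, f ω)) := by
      rw [← compProd_map_condDistrib h.measurable_f.aemeasurable, Measure.lintegral_compProd hF,
        lintegral_map hF.lintegral_kernel_prod_right' h_hist]

theorem setLIntegral_draw (h : IsRun P σn k m f ε U g x) {t : ℕ} (A : Fin t × Fin m → X)
    {Φ : (((X → ℝ) × (ℕ → Fin m → ℝ)) × 𝒰 × (Fin t → Fin m → X → ℝ)) × (Fin m → X → ℝ) → ℝ≥0∞}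
    (hΦ : Measurable Φ) :
    ∫⁻ ω in {ω | design x t ω = A}, Φ ((env f ε ω, internal U g t ω), g t ω) ∂P =
      ∫⁻ ω in {ω | design x t ω = A}, ∫⁻ w, Φ ((env f ε ω, internal U g t ω), w)
        ∂iidKernel (Fin m) (condDistrib f (history f ε x t) P) (A, obsAt A (env f ε ω)) ∂P := by
  obtain ⟨δ, hδ, hδ_eq⟩ := h.exists_design_eq t
  have hA := h.measurableSet_design_eq A
  have hS : MeasurableSet {p : (((X → ℝ) × (ℕ → Fin m → ℝ)) × 𝒰 × (Fin t → Fin m → X → ℝ)) ×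
      (Fin m → X → ℝ) | δ p.1 = A} :=
    measurableSet_eq_fun (hδ.comp measurable_fst) measurable_const
  rw [← lintegral_indicator hA, ← lintegral_indicator hA]
  convert h.lintegral_draw t (hΦ.indicator hS) using 3 with ω ω
  all_goals by_cases hω : design x t ω = A
  · simp [Set.indicator, ← hδ_eq, hω]
  · simp [Set.indicator, ← hδ_eq, hω]
  · simp [Set.indicator, ← hδ_eq, hω, history_eq_of_design_eq]
  · simp [Set.indicator, ← hδ_eq, hω]

/-- The next batch is chosen from the observations and the internal randomness. -/
theorem dependsOnlyOn_inter_batch (h : IsRun P σn k m f ε U g x) {t : ℕ} {A : Fin t × Fin m → X}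
    (hA : DependsOnlyOn P (env f ε) (obsAt A) (internal U g t) {ω | design x t ω = A})
    (S : Set (Fin m → X)) :
    DependsOnlyOn P (env f ε) (obsAt A) (internal U g (t + 1))
      ({ω | design x t ω = A} ∩ {ω | x t ω ∈ S}) := by
  have h_draw : DependsOnlyOn P (env f ε) (obsAt A) (internal U g (t + 1))
      {ω | design x t ω = A} := by
    have h_snoc : Measurable fun p : (𝒰 × (Fin t → Fin m → X → ℝ)) × (Fin m → X → ℝ) =>
        (p.1.1, (Fin.snoc p.1.2 p.2 : Fin (t + 1) → Fin m → X → ℝ)) := by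
      refine measurable_fst.fst.prodMk (measurable_pi_iff.2 fun s => ?_)
      cases s using Fin.lastCases with
      | last => simpa only [Fin.snoc_last] using by fun_prop
      | cast s => simpa only [Fin.snoc_castSucc] using by fun_prop
    convert ((hA.prodMk (measurable_obsAt_apply A)
      ((iidKernel (Fin m) (condDistrib f (history f ε x t) P)).comap (Prod.mk A)
        measurable_prodMk_left) fun Φ hΦ => h.setLIntegral_draw A hΦ).comp h_snoc) using 1
    refine funext fun ω => Prod.ext rfl (funext fun s => ?_)
    cases s using Fin.lastCases <;> simp [internal]
  obtain ⟨φ, hφ, hφ_eq⟩ := h.nonanticipating t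
  have hT : MeasurableSet {p : (Fin t × Fin m → ℝ) × 𝒰 × (Fin (t + 1) → Fin m → X → ℝ) |
      φ (p.2.1, (A, p.1), p.2.2) ∈ S} :=
    (hφ.comp (by fun_prop)) S.toFinite.measurableSet
  convert h_draw.inter h.measurable_env (measurable_obsAt_apply A) (h.measurable_internal (t + 1))
    hT using 1
  refine Set.ext fun ω => and_congr_right fun hω => ?_
  rw [Set.mem_ofPred_eq, hφ_eq, history_eq_of_design_eq hω]
  rfl

theorem dependsOnlyOn (h : IsRun P σn k m f ε U g x) (t : ℕ) (A : Fin t × Fin m → X) :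
    DependsOnlyOn P (env f ε) (obsAt A) (internal U g t) {ω | design x t ω = A} := by
  induction t with
  | zero =>
    have h_univ : {ω | design x 0 ω = A} = Set.univ :=
      Set.eq_univ_of_forall fun ω => funext fun p => p.1.elim0
    have h_internal : internal U g 0 = (fun u => (u, fun s => s.elim0)) ∘ U :=
      funext fun ω => Prod.ext rfl (funext fun s => s.elim0)
    rw [h_univ]
    refine DependsOnlyOn.of_indepFun h.measurable_env (h.measurable_internal 0) ?_ _
    rw [h_internal]
    exact h.indep_U.comp measurable_id (by fun_prop)
  | succ t ih =>
    obtain ⟨A₀, b, rfl⟩ : ∃ A₀ b, A = appendRound A₀ b :=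
      ⟨_, _, (appendRound_castSucc_last A).symm⟩
    have h_event : {ω | design x (t + 1) ω = appendRound A₀ b} =
        {ω | design x t ω = A₀} ∩ {ω | x t ω ∈ ({b} : Set (Fin m → X))} :=
      Set.ext fun ω => design_succ_eq_appendRound_iff
    have h_obs : obsAt A₀ = (fun y p => y (p.1.castSucc, p.2)) ∘ obsAt (appendRound A₀ b) := by
      ext v p
      simp [obsAt, observe]
    have h_batch := h.dependsOnlyOn_inter_batch (ih A₀) {b}
    rw [h_obs] at h_batch
    rw [h_event]
    exact h_batch.of_comp (by fun_prop)

/-- The algorithm's choices carry no information on the residual beyond the observations, and the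
residual is independent of the observations at a fixed design. -/
theorem restrict_map_residual (h : IsRun P σn k m f ε U g x) (hk : (Matrix.of k).PosSemidef)
    (hσn : 0 < σn) {t : ℕ} (A : Fin t × Fin m → X) (S : Set (Fin m → X)) (z : X) :
    (P.restrict ({ω | design x t ω = A} ∩ {ω | x t ω ∈ S})).map
        (fun ω => residual σn k A (f ω) (fun p => ε ω p.1 p.2) z) =
      P ({ω | design x t ω = A} ∩ {ω | x t ω ∈ S}) •
        gaussianReal 0 (postVar σn k A z).toNNReal := by
  have h_model := h.isGPModel t
  have hr : Measurable fun v : (X → ℝ) × (ℕ → Fin m → ℝ) =>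
      residual σn k A v.1 (fun p => v.2 p.1 p.2) z := by
    simp only [residual_eq_sub_sum hk, observe]
    fun_prop
  have h_indep := (h_model.indepFun_residual_observe hk hσn A).comp
    (measurable_pi_apply z) measurable_id
  rw [← h_model.map_residual hk hσn A z]
  exact (h.dependsOnlyOn_inter_batch (h.dependsOnlyOn t A) S).restrict_map h.measurable_env
    (measurable_obsAt_apply A) hr h_indep

end MeasurableSingletonClass

end IsRun

/-! ### The sum of posterior variances and the information gain -/

section InfoGain

variable {X : Type*} {k : X → X → ℝ} {σn : ℝ}

theorem le_mul_log_add_sub_log {v : ℝ} (hσn : 0 < σn) (hv : 0 ≤ v) (hv_le : v ≤ 1) :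
    v ≤ (1 + σn ^ 2) * (Real.log (σn ^ 2 + v) - 2 * Real.log σn) := by
  have h_log : v / (σn ^ 2 + v) ≤ Real.log (σn ^ 2 + v) - 2 * Real.log σn := by
    have h := Real.one_sub_inv_le_log_of_pos (x := (σn ^ 2 + v) / σn ^ 2) (by positivity)
    rw [Real.log_div (by positivity) (by positivity), Real.log_pow, Nat.cast_ofNat] at h
    refine le_of_eq_of_le ?_ h
    field_simp
    ring
  calc v = (σn ^ 2 + v) * (v / (σn ^ 2 + v)) := by field_simp
    _ ≤ (1 + σn ^ 2) * (v / (σn ^ 2 + v)) := by gcongr ?_ * _; linarith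
    _ ≤ (1 + σn ^ 2) * (Real.log (σn ^ 2 + v) - 2 * Real.log σn) := by gcongr

variable [Fintype X] [DecidableEq X] {m : ℕ}

theorem infoGain_le_maxInfoGain {n : ℕ} (A : Fin n → X) :
    infoGain σn k A ≤ maxInfoGain σn k n :=
  le_ciSup (Set.finite_range fun A : Fin n → X => infoGain σn k A).bddAbove A

theorem infoGain_batches (hk : (Matrix.of k).PosSemidef) (hσn : 0 < σn) (hk_pos : ∀ z, 0 < k z z)
    (b : ℕ → Fin m → X) (T : ℕ) :
    infoGain σn k (fun j : Fin (T * m) => b (finProdFinEquiv.symm j).1 (finProdFinEquiv.symm j).2) =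
      (∑ t ∈ Finset.range T, ∑ i, (Real.log (σn ^ 2 + postSdGiven σn k
        (fun p : Fin t × Fin m => b p.1 p.2) (fun j : {j : Fin m // j < i} => b t j) (b t i) ^ 2) -
          2 * Real.log σn)) / 2 := by
  have h_ne (t : ℕ) (i : Fin m) : σn ^ 2 + postSdGiven σn k (fun p : Fin t × Fin m => b p.1 p.2)
      (fun j : {j : Fin m // j < i} => b t j) (b t i) ^ 2 ≠ 0 := by positivity
  have h_det := det_gram_batches hk hσn b T
  simp only [← postSd_sq hk hσn _ (hk_pos _)] at h_det
  rw [infoGain_eq hk hσn, det_gram_congr (A := fun p : Fin T × Fin m => b p.1 p.2)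
    finProdFinEquiv.symm fun _ => rfl, h_det]
  simp only [postSdGiven] at h_ne ⊢
  rw [Real.log_prod fun t _ => Finset.prod_ne_zero_iff.2 fun i _ => h_ne t i]
  simp only [Real.log_prod fun i _ => h_ne _ i, Finset.sum_sub_distrib, Finset.sum_const,
    Finset.card_univ, Fintype.card_fin, Finset.card_range, nsmul_eq_mul, Nat.cast_mul]
  ring

theorem sum_postSdGiven_sq_le (hk : (Matrix.of k).PosSemidef) (hσn : 0 < σn)
    (hk_le : ∀ z, k z z ≤ 1) (hk_pos : ∀ z, 0 < k z z) (b : ℕ → Fin m → X) (T : ℕ) :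
    ∑ t ∈ Finset.range T, ∑ i, postSdGiven σn k (fun p : Fin t × Fin m => b p.1 p.2)
        (fun j : {j : Fin m // j < i} => b t j) (b t i) ^ 2 ≤
      2 * (1 + σn ^ 2) * maxInfoGain σn k (T * m) := by
  have h_le_one (t : ℕ) (i : Fin m) : postSdGiven σn k (fun p : Fin t × Fin m => b p.1 p.2)
      (fun j : {j : Fin m // j < i} => b t j) (b t i) ^ 2 ≤ 1 := by
    rw [postSdGiven, postSd_sq hk hσn _ (hk_pos _)]
    exact (postVar_le_self hk hσn _ _).trans (hk_le _)
  calc _ ≤ ∑ t ∈ Finset.range T, ∑ i, (1 + σn ^ 2) * (Real.log (σn ^ 2 + postSdGiven σn k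
        (fun p : Fin t × Fin m => b p.1 p.2) (fun j : {j : Fin m // j < i} => b t j) (b t i) ^ 2) -
          2 * Real.log σn) :=
      Finset.sum_le_sum fun t _ => Finset.sum_le_sum fun i _ =>
        le_mul_log_add_sub_log hσn (sq_nonneg _) (h_le_one t i)
    _ = 2 * (1 + σn ^ 2) * infoGain σn k fun j : Fin (T * m) =>
        b (finProdFinEquiv.symm j).1 (finProdFinEquiv.symm j).2 := by
      rw [infoGain_batches hk hσn hk_pos]
      simp only [← Finset.mul_sum]
      ring
    _ ≤ 2 * (1 + σn ^ 2) * maxInfoGain σn k (T * m) := by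
      gcongr
      exact infoGain_le_maxInfoGain _

theorem sum_postSdGiven_le (hk : (Matrix.of k).PosSemidef) (hσn : 0 < σn)
    (hk_le : ∀ z, k z z ≤ 1) (hk_pos : ∀ z, 0 < k z z) (b : ℕ → Fin m → X) (T : ℕ) :
    ∑ t ∈ Finset.range T, ∑ i, postSdGiven σn k (fun p : Fin t × Fin m => b p.1 p.2)
        (fun j : {j : Fin m // j < i} => b t j) (b t i) ≤
      √(2 * (1 + σn ^ 2)) * √((T * m : ℕ) * maxInfoGain σn k (T * m)) := by
  rw [← Real.sqrt_mul (by positivity)]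
  have h_sq := sum_postSdGiven_sq_le hk hσn hk_le hk_pos b T
  rw [← Finset.sum_product'] at h_sq ⊢
  refine Real.le_sqrt_of_sq_le (sq_sum_le_card_mul_sum_sq.trans ?_)
  rw [Finset.card_product, Finset.card_range, Finset.card_univ, Fintype.card_fin]
  refine (mul_le_mul_of_nonneg_left h_sq (by positivity)).trans_eq ?_
  ring

end InfoGain

/-! ### The ratios between posterior standard deviations -/

section Ratios

variable {X ι κ Ω : Type*} [Fintype ι] [DecidableEq ι] [Fintype κ] [DecidableEq κ]
  {k : X → X → ℝ} {σn : ℝ} {m T : ℕ}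

theorem sdRatios_le (hk : (Matrix.of k).PosSemidef) (hσn : 0 < σn) (hk_le : ∀ z, k z z ≤ 1)
    (hk_pos : ∀ z, 0 < k z z) {A : ι → X} {r : ℝ} (hr : r ∈ sdRatios σn k m A) :
    r ≤ √(1 + m / σn ^ 2) := by
  obtain ⟨z, j, hj, B, rfl⟩ := hr
  refine (postSd_div_postSdGiven_le hk hσn hk_le A B (hk_pos z)).trans (Real.sqrt_le_sqrt ?_)
  rw [Fintype.card_fin]
  gcongr

theorem div_mem_sdRatios (A : ι → X) (B : κ → X) (hκ : Fintype.card κ ≤ m) (z : X) :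
    postSd σn k A z / postSdGiven σn k A B z ∈ sdRatios σn k m A := by
  refine ⟨z, Fintype.card κ, hκ, B ∘ (Fintype.equivFin κ).symm, ?_⟩
  have h_congr : postVar σn k (Sum.elim A (B ∘ (Fintype.equivFin κ).symm)) z =
      postVar σn k (Sum.elim A B) z :=
    postVar_congr ((Equiv.refl ι).sumCongr (Fintype.equivFin κ).symm) (by rintro (_ | _) <;> rfl) z
  simp only [postSdGiven, postSd_eq_sqrt, h_congr]

theorem one_mem_sdRatios [Nonempty X] (hk : (Matrix.of k).PosSemidef) (hσn : 0 < σn)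
    (hk_pos : ∀ z, 0 < k z z) (A : ι → X) : (1 : ℝ) ∈ sdRatios σn k m A := by
  obtain ⟨z⟩ := ‹Nonempty X›
  refine ⟨z, 0, m.zero_le, Fin.elim0, ?_⟩
  have h_congr : postVar σn k (Sum.elim A Fin.elim0) z = postVar σn k A z :=
    postVar_congr (Equiv.sumEmpty ι (Fin 0)) (by rintro (_ | i) <;> [rfl; exact i.elim0]) z
  rw [postSdGiven, postSd_eq_sqrt _ z, postSd_eq_sqrt _ z, h_congr, ← postSd_eq_sqrt,
    div_self (postSd_pos hk hσn A (hk_pos z)).ne']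

theorem bddAbove_pathRatios (hk : (Matrix.of k).PosSemidef) (hσn : 0 < σn)
    (hk_le : ∀ z, k z z ≤ 1) (hk_pos : ∀ z, 0 < k z z) (x : ℕ → Ω → Fin m → X) (T : ℕ) (ω : Ω) :
    BddAbove {r | ∃ τ < T, r ∈ sdRatios σn k m (design x τ ω)} :=
  ⟨√(1 + m / σn ^ 2), fun _ ⟨_, _, hr⟩ => sdRatios_le hk hσn hk_le hk_pos hr⟩

theorem rhoPath_le (hk : (Matrix.of k).PosSemidef) (hσn : 0 < σn) (hk_le : ∀ z, k z z ≤ 1)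
    (hk_pos : ∀ z, 0 < k z z) (x : ℕ → Ω → Fin m → X) (T : ℕ) (ω : Ω) :
    rhoPath σn k x T ω ≤ √(1 + m / σn ^ 2) :=
  Real.sSup_le (fun _ ⟨_, _, hr⟩ => sdRatios_le hk hσn hk_le hk_pos hr) (Real.sqrt_nonneg _)

theorem one_le_rhoPath [Nonempty X] (hk : (Matrix.of k).PosSemidef) (hσn : 0 < σn)
    (hk_le : ∀ z, k z z ≤ 1) (hk_pos : ∀ z, 0 < k z z) (x : ℕ → Ω → Fin m → X) (hT : 0 < T)
    (ω : Ω) : 1 ≤ rhoPath σn k x T ω :=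
  le_csSup (bddAbove_pathRatios hk hσn hk_le hk_pos x T ω) ⟨0, hT, one_mem_sdRatios hk hσn hk_pos _⟩

theorem rhoPath_le_rho [Nonempty X] (hk : (Matrix.of k).PosSemidef) (hσn : 0 < σn)
    (hk_le : ∀ z, k z z ≤ 1) (hk_pos : ∀ z, 0 < k z z) (x : ℕ → Ω → Fin m → X) (hT : 0 < T)
    (ω : Ω) : rhoPath σn k x T ω ≤ rho σn k T m :=
  csSup_le_csSup
    ⟨√(1 + m / σn ^ 2), fun _ ⟨_, _, _, hr⟩ => sdRatios_le hk hσn hk_le hk_pos hr⟩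
    ⟨1, 0, hT, one_mem_sdRatios hk hσn hk_pos _⟩
    fun _ ⟨τ, hτ, hr⟩ => ⟨τ, hτ, _, hr⟩

theorem postSd_div_postSdGiven_le_rhoPath (hk : (Matrix.of k).PosSemidef) (hσn : 0 < σn)
    (hk_le : ∀ z, k z z ≤ 1) (hk_pos : ∀ z, 0 < k z z) (x : ℕ → Ω → Fin m → X) {t : ℕ}
    (ht : t < T) (ω : Ω) (i : Fin m) (z : X) :
    postSd σn k (design x t ω) z /
        postSdGiven σn k (design x t ω) (fun j : {j : Fin m // j < i} => x t ω j) z ≤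
      rhoPath σn k x T ω :=
  le_csSup (bddAbove_pathRatios hk hσn hk_le hk_pos x T ω)
    ⟨t, ht, div_mem_sdRatios _ _ ((Fintype.card_subtype_le _).trans (Fintype.card_fin m).le) z⟩

end Ratios

/-! ### Minimizers of the Regret-to-Sigma Ratio -/

theorem ciSup_sub_le_of_argmin {X : Type*} [Finite X] [Nonempty X] {v μ s sd : X → ℝ} {ρ c : ℝ}
    {y : X} (hs : ∀ z, 0 < s z) (hsd : ∀ z, 0 < sd z) (hρ : ∀ z, s z / sd z ≤ ρ)
    (hc : ∀ z, |(v z - μ z) / s z| ≤ c)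
    (hy : ∀ z, ((⨆ z', v z') - μ y) / sd y ≤ ((⨆ z', v z') - μ z) / sd z) :
    (⨆ z, v z) - μ y ≤ sd y * (ρ * c) := by
  obtain ⟨z, hz⟩ := exists_eq_ciSup_of_finite (f := v)
  have h_ratio : 0 < s z / sd z := div_pos (hs z) (hsd z)
  rw [mul_comm, ← div_le_iff₀ (hsd y)]
  calc ((⨆ z, v z) - μ y) / sd y ≤ (v z - μ z) / sd z := hz ▸ hy z
    _ = s z / sd z * ((v z - μ z) / s z) := by
      have := hs z
      field_simp
    _ ≤ s z / sd z * |(v z - μ z) / s z| := by gcongr; exact le_abs_self _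
    _ ≤ ρ * c := mul_le_mul (hρ z) (hc z) (abs_nonneg _) (h_ratio.le.trans (hρ z))

/-! ### Gaussian tails -/

section GaussianTail

variable {β : ℝ}

/-- Since `u ≤ exp u` with `u = β (|s| - β)`. -/
theorem max_abs_sub_le_exp (hβ : 0 < β) (s : ℝ) :
    max (|s| - β) 0 ≤ Real.exp (-β ^ 2) / β * (Real.exp (β * s) + Real.exp (-β * s)) := by
  refine max_le ?_ (by positivity)
  rw [div_mul_eq_mul_div, le_div_iff₀' hβ]
  calc β * (|s| - β) ≤ Real.exp (β * (|s| - β)) := by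
        linarith [Real.add_one_le_exp (β * (|s| - β))]
    _ = Real.exp (-β ^ 2) * Real.exp |β * s| := by
        rw [← Real.exp_add, abs_mul, abs_of_pos hβ]
        ring_nf
    _ ≤ Real.exp (-β ^ 2) * (Real.exp (β * s) + Real.exp (-β * s)) := by
        rw [neg_mul β]
        gcongr
        exact Real.exp_abs_le _

theorem integrable_max_abs_sub (hβ : 0 < β) :
    Integrable (fun s => max (|s| - β) 0) (gaussianReal 0 1) := by
  refine (((integrable_exp_mul_gaussianReal β).add
    (integrable_exp_mul_gaussianReal (-β))).const_mul (Real.exp (-β ^ 2) / β)).mono'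
    (by fun_prop) (Filter.Eventually.of_forall fun s => ?_)
  rw [Real.norm_of_nonneg (le_max_right _ _)]
  exact max_abs_sub_le_exp hβ s

theorem integral_max_abs_sub_le (hβ : 0 < β) :
    ∫ s, max (|s| - β) 0 ∂gaussianReal 0 1 ≤ 2 / β * Real.exp (-(β ^ 2 / 2)) := by
  have h_exp (t : ℝ) : ∫ s, Real.exp (t * s) ∂gaussianReal 0 1 = Real.exp (t ^ 2 / 2) := by
    simpa [mgf] using congrFun (mgf_id_gaussianReal (μ := 0) (v := 1)) t
  have hi := integrable_exp_mul_gaussianReal (μ := 0) (v := 1) β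
  have hi' := integrable_exp_mul_gaussianReal (μ := 0) (v := 1) (-β)
  calc ∫ s, max (|s| - β) 0 ∂gaussianReal 0 1
    _ ≤ ∫ s, Real.exp (-β ^ 2) / β * (Real.exp (β * s) + Real.exp (-β * s)) ∂gaussianReal 0 1 :=
      integral_mono (integrable_max_abs_sub hβ) ((hi.add hi').const_mul _)
        fun s => max_abs_sub_le_exp hβ s
    _ = 2 / β * (Real.exp (-β ^ 2) * Real.exp (β ^ 2 / 2)) := by
      rw [integral_const_mul, integral_add hi hi', h_exp, h_exp, neg_sq]
      ring
    _ = 2 / β * Real.exp (-(β ^ 2 / 2)) := by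
      rw [← Real.exp_add]
      ring_nf

end GaussianTail

/-! ### Partitioning along a finite-valued random variable -/

section Partition

variable {Ω ι : Type*} [MeasurableSpace Ω] [MeasurableSpace ι] [MeasurableSingletonClass ι]
  {μ : Measure Ω} {J : Ω → ι} {F : ι → Ω → ℝ}

theorem measurableSet_fiber (hJ : Measurable J) (j : ι) : MeasurableSet {ω | J ω = j} :=
  hJ (measurableSet_singleton j)

theorem integrableOn_eval_fiber (hJ : Measurable J) {j : ι} (hF : Integrable (F j) μ) :
    IntegrableOn (fun ω => F (J ω) ω) {ω | J ω = j} μ :=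
  hF.integrableOn.congr_fun (fun _ hω => by rw [Set.mem_ofPred_eq.mp hω]) (measurableSet_fiber hJ j)

theorem sum_restrict_fiber [Fintype ι] (hJ : Measurable J) :
    ∑ j, μ.restrict {ω | J ω = j} = μ := by
  have h_union : ⋃ j, {ω | J ω = j} = Set.univ := Set.eq_univ_of_forall fun ω => by simp
  rw [← Measure.sum_fintype, ← Measure.restrict_iUnion (fun _ _ h => Set.disjoint_left.2
    fun _ h₁ h₂ => h (h₁.symm.trans h₂)) (measurableSet_fiber hJ), h_union, Measure.restrict_univ]

theorem integrable_eval [Finite ι] (hJ : Measurable J) (hF : ∀ j, Integrable (F j) μ) :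
    Integrable (fun ω => F (J ω) ω) μ := by
  cases nonempty_fintype ι
  rw [← sum_restrict_fiber (μ := μ) hJ, integrable_finsetSum_measure]
  exact fun j _ => integrableOn_eval_fiber hJ (hF j)

theorem integral_eval_eq_sum [Fintype ι] (hJ : Measurable J) (hF : ∀ j, Integrable (F j) μ) :
    ∫ ω, F (J ω) ω ∂μ = ∑ j, ∫ ω in {ω | J ω = j}, F j ω ∂μ := by
  conv_lhs => rw [← sum_restrict_fiber (μ := μ) hJ]
  rw [integral_finsetSum_measure fun j _ => integrableOn_eval_fiber hJ (hF j)]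
  exact Finset.sum_congr rfl fun j _ => setIntegral_congr_fun (measurableSet_fiber hJ j)
    fun _ hω => by rw [Set.mem_ofPred_eq.mp hω]

end Partition

/-! ### Standardized residuals -/

section StdResidual

variable {X ι : Type*} [Fintype ι] [DecidableEq ι] {σn : ℝ} {k : X → X → ℝ}

/-- The deviation of `v z` from the posterior mean given the data `p`, in units of the posterior
standard deviation. -/
def stdResidual (σn : ℝ) (k : X → X → ℝ) (p : (ι → X) × (ι → ℝ)) (v : X → ℝ) (z : X) : ℝ :=
  (v z - postMean σn k p.1 p.2 z) / postSd σn k p.1 z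

variable [Finite X] [MeasurableSpace X] [MeasurableSingletonClass X]

theorem measurable_stdResidual (hk : (Matrix.of k).PosSemidef) (z : X) :
    Measurable fun p : ((ι → X) × (ι → ℝ)) × (X → ℝ) => stdResidual σn k p.1 p.2 z := by
  have h_mean : Measurable fun p : (ι → X) × (ι → ℝ) => postMean σn k p.1 p.2 z := by
    refine measurable_from_prod_countable_right fun A => ?_
    simp only [postMean_eq_dotProduct hk, dotProduct]
    fun_prop
  have h_sd : Measurable fun A : ι → X => postSd σn k A z := .of_discrete
  unfold stdResidual
  fun_prop

end StdResidual

theorem iSup_draw_sub_postMean_eq {Ω X : Type*} {m : ℕ} {σn : ℝ} {k : X → X → ℝ} (f : Ω → X → ℝ)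
    {ε : Ω → ℕ → Fin m → ℝ} {g : ℕ → Ω → Fin m → X → ℝ} {x : ℕ → Ω → Fin m → X} (t : ℕ) (i : Fin m)
    (ω : Ω) :
    (⨆ z, g t ω i z) - postMean σn k (design x t ω) (observed f ε x t ω) (x t ω i) =
      (⨆ z, g t ω i z) - f ω (x t ω i) +
        residual σn k (design x t ω) (f ω) (fun p => ε ω p.1 p.2) (x t ω i) :=
  (sub_add_sub_cancel _ _ _).symm

namespace IsRun

variable {Ω X 𝒰 : Type*} [MeasurableSpace Ω] [Fintype X] [DecidableEq X] [MeasurableSpace X]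
  [MeasurableSpace 𝒰] {P : Measure Ω} [IsProbabilityMeasure P]
  {σn : ℝ} {k : X → X → ℝ} {m : ℕ} {f : Ω → X → ℝ} {ε : Ω → ℕ → Fin m → ℝ} {U : Ω → 𝒰}
  {g : ℕ → Ω → Fin m → X → ℝ} {x : ℕ → Ω → Fin m → X}

theorem integrable_f (h : IsRun P σn k m f ε U g x) (z : X) : Integrable (fun ω => f ω z) P :=
  ((h.isGPModel 0).memLp_f z).integrable one_le_two

theorem integrable_iSup_f [Nonempty X] (h : IsRun P σn k m f ε U g x) :
    Integrable (fun ω => ⨆ z, f ω z) P := by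
  refine (integrable_finsetSum Finset.univ fun z _ => (h.integrable_f z).abs).mono'
    (Measurable.iSup fun z =>
      (measurable_pi_apply z).comp h.measurable_f).aestronglyMeasurable
    (Filter.Eventually.of_forall fun ω => ?_)
  obtain ⟨z, hz⟩ := exists_eq_ciSup_of_finite (f := f ω)
  rw [← hz]
  exact Finset.single_le_sum (f := fun z => |f ω z|) (fun _ _ => abs_nonneg _) (Finset.mem_univ z)

theorem integrable_residual (h : IsRun P σn k m f ε U g x) (hk : (Matrix.of k).PosSemidef)
    {t : ℕ} (A : Fin t × Fin m → X) (z : X) :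
    Integrable (fun ω => residual σn k A (f ω) (fun p => ε ω p.1 p.2) z) P :=
  ((h.isGPModel t).memLp_residual hk A z).integrable one_le_two

variable [MeasurableSingletonClass X]

theorem identDistrib_history_draw (h : IsRun P σn k m f ε U g x) (t : ℕ) (i : Fin m) :
    IdentDistrib (fun ω => (history f ε x t ω, g t ω i)) (fun ω => (history f ε x t ω, f ω))
      P P where
  aemeasurable_fst := ((h.measurable_history t).prodMk
    ((measurable_pi_apply i).comp (h.measurable_g t))).aemeasurable
  aemeasurable_snd := ((h.measurable_history t).prodMk h.measurable_f).aemeasurable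
  map_eq := h.map_history_draw t i

theorem identDistrib_iSup_draw [Nonempty X] (h : IsRun P σn k m f ε U g x) (t : ℕ) (i : Fin m) :
    IdentDistrib (fun ω => ⨆ z, g t ω i z) (fun ω => ⨆ z, f ω z) P P :=
  (h.identDistrib_history_draw t i).comp
    (u := fun p : ((Fin t × Fin m → X) × (Fin t × Fin m → ℝ)) × (X → ℝ) => ⨆ z, p.2 z)
    (Measurable.iSup fun z => (measurable_pi_apply z).comp measurable_snd)

/-! ### The law of the standardized residuals along a run -/

theorem restrict_map_stdResidual (h : IsRun P σn k m f ε U g x) (hk : (Matrix.of k).PosSemidef)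
    (hσn : 0 < σn) {t : ℕ} (A : Fin t × Fin m → X) {z : X} (hz : 0 < k z z) :
    (P.restrict ({ω | design x t ω = A})).map
        (fun ω => stdResidual σn k (history f ε x t ω) (f ω) z) =
      P ({ω | design x t ω = A}) • gaussianReal 0 1 := by
  have h_std : (fun ω => stdResidual σn k (history f ε x t ω) (f ω) z) =ᵐ[P.restrict
      ({ω | design x t ω = A})] (fun r => r / postSd σn k A z) ∘
        fun ω => residual σn k A (f ω) (fun p => ε ω p.1 p.2) z := by
    refine ae_restrict_of_forall_mem (h.measurableSet_design_eq A) fun ω hω => ?_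
    simp only [history_eq_of_design_eq hω]
    rfl
  have h_residual : AEMeasurable (fun ω => residual σn k A (f ω) (fun p => ε ω p.1 p.2) z)
      (P.restrict ({ω | design x t ω = A})) :=
    ((h.isGPModel t).memLp_residual hk A z).aestronglyMeasurable.aemeasurable.restrict
  have h_map := h.restrict_map_residual hk hσn A Set.univ z
  simp only [Set.mem_univ, Set.ofPred_true, Set.inter_univ] at h_map
  have h_scale : (postVar σn k A z).toNNReal / .mk (postSd σn k A z ^ 2) (sq_nonneg _) = 1 := by
    have h_pos := postVar_pos hk hσn A hz
    refine NNReal.eq ?_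
    rw [NNReal.coe_div, NNReal.coe_mk, Real.coe_toNNReal _ h_pos.le, postSd_sq hk hσn A hz,
      div_self h_pos.ne', NNReal.coe_one]
  rw [Measure.map_congr h_std, ← AEMeasurable.map_map_of_aemeasurable (by fun_prop) h_residual,
    h_map, Measure.map_smul, gaussianReal_map_div_const, zero_div, h_scale]

theorem map_stdResidual (h : IsRun P σn k m f ε U g x) (hk : (Matrix.of k).PosSemidef)
    (hσn : 0 < σn) (t : ℕ) {z : X} (hz : 0 < k z z) :
    P.map (fun ω => stdResidual σn k (history f ε x t ω) (f ω) z) = gaussianReal 0 1 := by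
  have hm : Measurable fun ω => stdResidual σn k (history f ε x t ω) (f ω) z :=
    (measurable_stdResidual hk z).comp ((h.measurable_history t).prodMk h.measurable_f)
  have h_sum := sum_restrict_fiber (μ := P) (h.measurable_design t)
  have h_total : ∑ A, P ({ω | design x t ω = A}) = 1 := by
    simpa using congrArg (fun ν => ν Set.univ) h_sum
  conv_lhs => rw [← h_sum, ← Measure.mapₗ_apply_of_measurable hm, map_sum]
  simp only [Measure.mapₗ_apply_of_measurable hm, h.restrict_map_stdResidual hk hσn _ hz]
  rw [← Finset.sum_smul, h_total, one_smul]

theorem map_stdResidual_draw (h : IsRun P σn k m f ε U g x) (hk : (Matrix.of k).PosSemidef)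
    (hσn : 0 < σn) (t : ℕ) (i : Fin m) {z : X} (hz : 0 < k z z) :
    P.map (fun ω => stdResidual σn k (history f ε x t ω) (g t ω i) z) = gaussianReal 0 1 :=
  ((h.identDistrib_history_draw t i).comp (measurable_stdResidual hk z)).map_eq.trans
    (h.map_stdResidual hk hσn t hz)

/-! ### Integrability and expectations along a run -/

theorem measurable_design_batch (h : IsRun P σn k m f ε U g x) (t : ℕ) :
    Measurable fun ω => (design x t ω, x t ω) :=
  (h.measurable_design t).prodMk (h.measurable_x t)

theorem integrable_f_x (h : IsRun P σn k m f ε U g x) (t : ℕ) (i : Fin m) :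
    Integrable (fun ω => f ω (x t ω i)) P :=
  integrable_eval ((measurable_pi_apply i).comp (h.measurable_x t)) h.integrable_f

theorem integrable_regret [Nonempty X] (h : IsRun P σn k m f ε U g x) (T : ℕ) :
    Integrable (regret f x T) P :=
  integrable_finsetSum _ fun t _ => integrable_finsetSum _ fun i _ =>
    h.integrable_iSup_f.sub (h.integrable_f_x t i)

theorem setIntegral_residual (h : IsRun P σn k m f ε U g x) (hk : (Matrix.of k).PosSemidef)
    (hσn : 0 < σn) {t : ℕ} (A : Fin t × Fin m → X) (S : Set (Fin m → X)) (z : X) :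
    ∫ ω in {ω | design x t ω = A} ∩ {ω | x t ω ∈ S},
      residual σn k A (f ω) (fun p => ε ω p.1 p.2) z ∂P = 0 := by
  rw [← integral_map (f := fun r => r)
    (h.integrable_residual hk A z).aestronglyMeasurable.aemeasurable.restrict
    aestronglyMeasurable_id, h.restrict_map_residual hk hσn, integral_smul_measure,
    integral_id_gaussianReal, smul_zero]

theorem integrable_residual_x (h : IsRun P σn k m f ε U g x) (hk : (Matrix.of k).PosSemidef)
    (t : ℕ) (i : Fin m) :
    Integrable (fun ω =>
      residual σn k (design x t ω) (f ω) (fun p => ε ω p.1 p.2) (x t ω i)) P :=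
  integrable_eval (h.measurable_design_batch t) fun p => h.integrable_residual hk p.1 (p.2 i)

theorem integral_residual_x (h : IsRun P σn k m f ε U g x) (hk : (Matrix.of k).PosSemidef)
    (hσn : 0 < σn) (t : ℕ) (i : Fin m) :
    ∫ ω, residual σn k (design x t ω) (f ω) (fun p => ε ω p.1 p.2) (x t ω i) ∂P = 0 := by
  refine (integral_eval_eq_sum (h.measurable_design_batch t)
    fun p => h.integrable_residual hk p.1 (p.2 i)).trans (Finset.sum_eq_zero fun p _ => ?_)
  have h_event : {ω | (design x t ω, x t ω) = p} =
      {ω | design x t ω = p.1} ∩ {ω | x t ω ∈ ({p.2} : Set (Fin m → X))} :=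
    Set.ext fun ω => Prod.ext_iff
  rw [h_event]
  exact h.setIntegral_residual hk hσn p.1 {p.2} (p.2 i)

theorem integrable_iSup_draw_sub_postMean [Nonempty X] (h : IsRun P σn k m f ε U g x)
    (hk : (Matrix.of k).PosSemidef) (t : ℕ) (i : Fin m) :
    Integrable (fun ω => (⨆ z, g t ω i z) -
      postMean σn k (design x t ω) (observed f ε x t ω) (x t ω i)) P := by
  simp only [iSup_draw_sub_postMean_eq f]
  exact (((h.identDistrib_iSup_draw t i).integrable_iff.2 h.integrable_iSup_f).sub
    (h.integrable_f_x t i)).add (h.integrable_residual_x hk t i)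

/-- The sampled maximum has the law of the true one, and the residual at a point chosen from the
history and internal randomness has mean zero. -/
theorem integral_iSup_sub_f_x [Nonempty X] (h : IsRun P σn k m f ε U g x)
    (hk : (Matrix.of k).PosSemidef) (hσn : 0 < σn) (t : ℕ) (i : Fin m) :
    ∫ ω, ((⨆ z, f ω z) - f ω (x t ω i)) ∂P = ∫ ω, ((⨆ z, g t ω i z) -
      postMean σn k (design x t ω) (observed f ε x t ω) (x t ω i)) ∂P := by
  have h_iSup := h.identDistrib_iSup_draw t i
  have h_draw := h_iSup.integrable_iff.2 h.integrable_iSup_f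
  have h_x := h.integrable_f_x t i
  have h_gap : Integrable (fun ω => (⨆ z, g t ω i z) - f ω (x t ω i)) P := h_draw.sub h_x
  simp only [iSup_draw_sub_postMean_eq f]
  rw [integral_add h_gap (h.integrable_residual_x hk t i),
    h.integral_residual_x hk hσn, add_zero, integral_sub h_draw h_x,
    integral_sub h.integrable_iSup_f h_x, h_iSup.integral_eq]

theorem integral_regret_eq [Nonempty X] (h : IsRun P σn k m f ε U g x)
    (hk : (Matrix.of k).PosSemidef) (hσn : 0 < σn) (T : ℕ) :
    ∫ ω, regret f x T ω ∂P = ∫ ω, ∑ t ∈ Finset.range T, ∑ i, ((⨆ z, g t ω i z) -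
      postMean σn k (design x t ω) (observed f ε x t ω) (x t ω i)) ∂P := by
  have h_regret (t : ℕ) (i : Fin m) : Integrable (fun ω => (⨆ z, f ω z) - f ω (x t ω i)) P :=
    h.integrable_iSup_f.sub (h.integrable_f_x t i)
  have h_gap := h.integrable_iSup_draw_sub_postMean hk
  unfold regret
  rw [integral_finsetSum _ fun t _ => integrable_finsetSum _ fun i _ => h_regret t i,
    integral_finsetSum _ fun t _ => integrable_finsetSum _ fun i _ => h_gap t i]
  refine Finset.sum_congr rfl fun t _ => ?_
  rw [integral_finsetSum _ fun i _ => h_regret t i, integral_finsetSum _ fun i _ => h_gap t i]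
  exact Finset.sum_congr rfl fun i _ => h.integral_iSup_sub_f_x hk hσn t i

theorem measurable_rhoPath (h : IsRun P σn k m f ε U g x) (T : ℕ) :
    Measurable (rhoPath σn k x T) := by
  let F (A : Fin T × Fin m → X) : ℝ := sSup {r | ∃ (τ : ℕ) (hτ : τ < T),
    r ∈ sdRatios σn k m fun p : Fin τ × Fin m => A (p.1.castLE hτ.le, p.2)}
  have h_eq : rhoPath σn k x T = F ∘ design x T :=
    funext fun ω => congrArg sSup (Set.ext fun r => exists_congr fun τ => exists_prop.symm)
  rw [h_eq]
  exact Measurable.of_discrete.comp (h.measurable_design T)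

theorem integrable_rhoPath [Nonempty X] (h : IsRun P σn k m f ε U g x)
    (hk : (Matrix.of k).PosSemidef) (hσn : 0 < σn) (hk_le : ∀ z, k z z ≤ 1)
    (hk_pos : ∀ z, 0 < k z z) {T : ℕ} (hT : 0 < T) : Integrable (rhoPath σn k x T) P := by
  refine .of_bound (h.measurable_rhoPath T).aestronglyMeasurable (√(1 + m / σn ^ 2))
    (Filter.Eventually.of_forall fun ω => ?_)
  rw [Real.norm_of_nonneg (zero_le_one.trans (one_le_rhoPath hk hσn hk_le hk_pos x hT ω))]
  exact rhoPath_le hk hσn hk_le hk_pos x T ω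

end IsRun

/-! ### The confidence level -/

section ConfidenceLevel

variable {D n : ℝ}

theorem half_le_log_mul_pow (hD : 2 ≤ D) (hn : 1 ≤ n) (j : ℕ) : 1 / 2 ≤ Real.log (D * n ^ j) := by
  have h_two_le : 2 ≤ D * n ^ j :=
    hD.trans (le_mul_of_one_le_right (zero_le_two.trans hD) (one_le_pow₀ hn))
  linarith [Real.log_le_log two_pos h_two_le, Real.log_two_gt_d9]

theorem exp_neg_sq_sqrt_two_mul_log_div_two {a : ℝ} (ha : 1 ≤ a) :
    Real.exp (-(√(2 * Real.log a) ^ 2 / 2)) = a⁻¹ := by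
  rw [Real.sq_sqrt (mul_nonneg zero_le_two (Real.log_nonneg ha)),
    mul_div_cancel_left₀ _ two_ne_zero, Real.exp_neg, Real.exp_log (by linarith)]

theorem mul_gaussian_tail_le (hD : 2 ≤ D) (hn : 1 ≤ n) :
    n * D * (2 / √(2 * Real.log (D * n ^ 3)) *
      Real.exp (-(√(2 * Real.log (D * n ^ 3)) ^ 2 / 2))) ≤ 2 / n := by
  have h_one_le : 1 ≤ √(2 * Real.log (D * n ^ 3)) :=
    Real.one_le_sqrt.2 (by linarith [half_le_log_mul_pow hD hn 3])
  have h_sq : n ≤ n ^ 2 := le_self_pow₀ hn two_ne_zero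
  rw [exp_neg_sq_sqrt_two_mul_log_div_two
    (one_le_mul_of_one_le_of_one_le (by linarith) (one_le_pow₀ hn))]
  calc n * D * (2 / √(2 * Real.log (D * n ^ 3)) * (D * n ^ 3)⁻¹)
      ≤ n * D * (2 / 1 * (D * n ^ 3)⁻¹) := by gcongr
    _ = 2 / n ^ 2 := by field_simp
    _ ≤ 2 / n := by gcongr

theorem sqrt_one_add_div_le_mul {a b : ℝ} (hn : 1 ≤ n) (ha : a ≤ n) (hb : 0 ≤ b) :
    √(1 + a / b) ≤ n * √(1 + 1 / b) := by
  rw [← Real.sqrt_sq (zero_le_one.trans hn), ← Real.sqrt_mul (sq_nonneg n), mul_add, mul_one,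
    mul_one_div]
  have h_sq : n ≤ n ^ 2 := le_self_pow₀ hn two_ne_zero
  gcongr
  · exact hn.trans h_sq
  · exact ha.trans h_sq

theorem mul_sqrt_two_mul_add_le {E L a c e : ℝ} (hE : 1 ≤ E) (hL : 1 / 2 ≤ L) (hn : 0 < n)
    (ha : 0 ≤ a) (hac : a ≤ n * c) (he : e ≤ 2 / n) :
    E * √(2 * L) + a * e ≤ (√2 + 4 * c) * (E * √L) := by
  have hc : 0 ≤ c := nonneg_of_mul_nonneg_right (ha.trans hac) hn
  have h_half : 1 / 2 ≤ E * √L :=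
    (Real.le_sqrt_of_sq_le (by linarith)).trans (le_mul_of_one_le_left L.sqrt_nonneg hE)
  have h_excess : a * e ≤ 2 * c :=
    calc a * e ≤ a * (2 / n) := by gcongr
      _ ≤ n * c * (2 / n) := by gcongr
      _ = 2 * c := by field_simp
  rw [Real.sqrt_mul zero_le_two]
  linarith [mul_le_mul_of_nonneg_left h_half hc]

end ConfidenceLevel

/-! ### The regret bound -/

/-- The total amount by which the standardized residuals of the draws of the first `T` rounds
exceed `β` in absolute value. -/
def excess {Ω X : Type*} [Fintype X] {m : ℕ} (σn : ℝ) (k : X → X → ℝ) (f : Ω → X → ℝ)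
    (ε : Ω → ℕ → Fin m → ℝ) (g : ℕ → Ω → Fin m → X → ℝ) (x : ℕ → Ω → Fin m → X)
    (β : ℝ) (T : ℕ) (ω : Ω) : ℝ :=
  ∑ p ∈ Finset.range T ×ˢ (Finset.univ : Finset (Fin m × X)),
    max (|stdResidual σn k (history f ε x p.1 ω) (g p.1 ω p.2.1) p.2.2| - β) 0

section Excess

variable {Ω X : Type*} [Fintype X] {m : ℕ} (σn : ℝ) (k : X → X → ℝ) (f : Ω → X → ℝ)
  (ε : Ω → ℕ → Fin m → ℝ) (g : ℕ → Ω → Fin m → X → ℝ) (x : ℕ → Ω → Fin m → X) (β : ℝ)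

theorem excess_nonneg (T : ℕ) (ω : Ω) : 0 ≤ excess σn k f ε g x β T ω :=
  Finset.sum_nonneg fun _ _ => le_max_right _ _

theorem abs_stdResidual_le_add_excess {t T : ℕ} (ht : t < T) (ω : Ω) (i : Fin m) (z : X) :
    |stdResidual σn k (history f ε x t ω) (g t ω i) z| ≤ β + excess σn k f ε g x β T ω := by
  have h_single := Finset.single_le_sum
    (f := fun p : ℕ × Fin m × X =>
      max (|stdResidual σn k (history f ε x p.1 ω) (g p.1 ω p.2.1) p.2.2| - β) 0)
    (s := Finset.range T ×ˢ Finset.univ) (fun _ _ => le_max_right _ _)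
    (Finset.mk_mem_product (Finset.mem_range.2 ht) (Finset.mem_univ (i, z)))
  exact sub_le_iff_le_add'.1 ((le_max_left _ _).trans h_single)

end Excess

namespace IsRun

variable {Ω X 𝒰 : Type*} [MeasurableSpace Ω] [Fintype X] [DecidableEq X] [MeasurableSpace X]
  [MeasurableSpace 𝒰] {P : Measure Ω} [IsProbabilityMeasure P]
  {σn : ℝ} {k : X → X → ℝ} {m : ℕ} {f : Ω → X → ℝ} {ε : Ω → ℕ → Fin m → ℝ} {U : Ω → 𝒰}
  {g : ℕ → Ω → Fin m → X → ℝ} {x : ℕ → Ω → Fin m → X}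

theorem iSup_draw_sub_postMean_le [Nonempty X] (h : IsRun P σn k m f ε U g x)
    (hk : (Matrix.of k).PosSemidef) (hσn : 0 < σn) (hk_le : ∀ z, k z z ≤ 1)
    (hk_pos : ∀ z, 0 < k z z) (β : ℝ) {t T : ℕ} (ht : t < T) (i : Fin m) :
    ∀ᵐ ω ∂P, (⨆ z, g t ω i z) - postMean σn k (design x t ω) (observed f ε x t ω) (x t ω i) ≤
      postSdGiven σn k (design x t ω) (fun j : {j : Fin m // j < i} => x t ω j) (x t ω i) *
        (rhoPath σn k x T ω * β + √(1 + m / σn ^ 2) * excess σn k f ε g x β T ω) := by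
  filter_upwards [h.argmin t i] with ω h_argmin
  refine (ciSup_sub_le_of_argmin (s := postSd σn k (design x t ω))
    (fun z => postSd_pos hk hσn _ (hk_pos z)) (fun z => postSd_pos hk hσn _ (hk_pos z))
    (fun z => postSd_div_postSdGiven_le_rhoPath hk hσn hk_le hk_pos x ht ω i z)
    (fun z => abs_stdResidual_le_add_excess σn k f ε g x β ht ω i z) h_argmin).trans
    (mul_le_mul_of_nonneg_left ?_ (postSd_pos hk hσn _ (hk_pos _)).le)
  rw [mul_add]
  gcongr
  · exact excess_nonneg σn k f ε g x β T ω
  · exact rhoPath_le hk hσn hk_le hk_pos x T ω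

theorem sum_iSup_draw_sub_postMean_le [Nonempty X] (h : IsRun P σn k m f ε U g x)
    (hk : (Matrix.of k).PosSemidef) (hσn : 0 < σn) (hk_le : ∀ z, k z z ≤ 1)
    (hk_pos : ∀ z, 0 < k z z) {T : ℕ} (hT : 0 < T) {β : ℝ} (hβ : 0 ≤ β) :
    ∀ᵐ ω ∂P, ∑ t ∈ Finset.range T, ∑ i, ((⨆ z, g t ω i z) -
        postMean σn k (design x t ω) (observed f ε x t ω) (x t ω i)) ≤
      √(2 * (1 + σn ^ 2)) * √((T * m : ℕ) * maxInfoGain σn k (T * m)) *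
        (rhoPath σn k x T ω * β + √(1 + m / σn ^ 2) * excess σn k f ε g x β T ω) := by
  filter_upwards [ae_all_iff.2 fun t => ae_all_iff.2 fun ht : t < T => ae_all_iff.2 fun i =>
    h.iSup_draw_sub_postMean_le hk hσn hk_le hk_pos β ht i] with ω h_slots
  have h_nonneg : 0 ≤ rhoPath σn k x T ω * β +
      √(1 + m / σn ^ 2) * excess σn k f ε g x β T ω :=
    add_nonneg
      (mul_nonneg (zero_le_one.trans (one_le_rhoPath hk hσn hk_le hk_pos x hT ω)) hβ)
      (mul_nonneg (Real.sqrt_nonneg _) (excess_nonneg σn k f ε g x β T ω))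
  refine (Finset.sum_le_sum fun t ht => Finset.sum_le_sum fun i _ =>
    h_slots t (Finset.mem_range.1 ht) i).trans ?_
  simp only [← Finset.sum_mul]
  exact mul_le_mul_of_nonneg_right
    (sum_postSdGiven_le hk hσn hk_le hk_pos (fun t => x t ω) T) h_nonneg

variable [MeasurableSingletonClass X]

theorem measurable_stdResidual_draw (h : IsRun P σn k m f ε U g x)
    (hk : (Matrix.of k).PosSemidef) (t : ℕ) (i : Fin m) (z : X) :
    Measurable fun ω => stdResidual σn k (history f ε x t ω) (g t ω i) z :=
  (measurable_stdResidual hk z).comp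
    ((h.measurable_history t).prodMk ((measurable_pi_apply i).comp (h.measurable_g t)))

theorem integrable_max_stdResidual (h : IsRun P σn k m f ε U g x) (hk : (Matrix.of k).PosSemidef)
    (hσn : 0 < σn) {β : ℝ} (hβ : 0 < β) (t : ℕ) (i : Fin m) {z : X} (hz : 0 < k z z) :
    Integrable (fun ω => max (|stdResidual σn k (history f ε x t ω) (g t ω i) z| - β) 0) P := by
  have h_gaussian := integrable_max_abs_sub hβ
  rw [← h.map_stdResidual_draw hk hσn t i hz] at h_gaussian
  exact h_gaussian.comp_measurable (h.measurable_stdResidual_draw hk t i z)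

theorem integral_max_stdResidual_le (h : IsRun P σn k m f ε U g x) (hk : (Matrix.of k).PosSemidef)
    (hσn : 0 < σn) {β : ℝ} (hβ : 0 < β) (t : ℕ) (i : Fin m) {z : X} (hz : 0 < k z z) :
    ∫ ω, max (|stdResidual σn k (history f ε x t ω) (g t ω i) z| - β) 0 ∂P ≤
      2 / β * Real.exp (-(β ^ 2 / 2)) := by
  have h_gaussian := integral_max_abs_sub_le hβ
  rwa [← h.map_stdResidual_draw hk hσn t i hz,
    integral_map (h.measurable_stdResidual_draw hk t i z).aemeasurable (by fun_prop)] at h_gaussian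

theorem integrable_excess (h : IsRun P σn k m f ε U g x) (hk : (Matrix.of k).PosSemidef)
    (hσn : 0 < σn) (hk_pos : ∀ z, 0 < k z z) {β : ℝ} (hβ : 0 < β) (T : ℕ) :
    Integrable (excess σn k f ε g x β T) P :=
  integrable_finsetSum _ fun p _ =>
    h.integrable_max_stdResidual hk hσn hβ p.1 p.2.1 (hk_pos p.2.2)

theorem integral_excess_le (h : IsRun P σn k m f ε U g x) (hk : (Matrix.of k).PosSemidef)
    (hσn : 0 < σn) (hk_pos : ∀ z, 0 < k z z) {β : ℝ} (hβ : 0 < β) (T : ℕ) :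
    ∫ ω, excess σn k f ε g x β T ω ∂P ≤
      (T * m : ℕ) * Fintype.card X * (2 / β * Real.exp (-(β ^ 2 / 2))) := by
  unfold excess
  rw [integral_finsetSum _ fun p _ =>
    h.integrable_max_stdResidual hk hσn hβ p.1 p.2.1 (hk_pos p.2.2)]
  refine (Finset.sum_le_card_nsmul _ _ _ fun p _ =>
    h.integral_max_stdResidual_le hk hσn hβ p.1 p.2.1 (hk_pos p.2.2)).trans_eq ?_
  simp only [Finset.card_product, Finset.card_range, Finset.card_univ, Fintype.card_prod,
    Fintype.card_fin, nsmul_eq_mul, Nat.cast_mul, mul_assoc]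

theorem one_le_integral_rhoPath [Nonempty X] (h : IsRun P σn k m f ε U g x)
    (hk : (Matrix.of k).PosSemidef) (hσn : 0 < σn) (hk_le : ∀ z, k z z ≤ 1)
    (hk_pos : ∀ z, 0 < k z z) {T : ℕ} (hT : 0 < T) : 1 ≤ ∫ ω, rhoPath σn k x T ω ∂P := by
  simpa using integral_mono (μ := P) (integrable_const (1 : ℝ))
    (h.integrable_rhoPath hk hσn hk_le hk_pos hT)
    fun ω => one_le_rhoPath hk hσn hk_le hk_pos x hT ω

theorem integral_rhoPath_le_rho [Nonempty X] (h : IsRun P σn k m f ε U g x)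
    (hk : (Matrix.of k).PosSemidef) (hσn : 0 < σn) (hk_le : ∀ z, k z z ≤ 1)
    (hk_pos : ∀ z, 0 < k z z) {T : ℕ} (hT : 0 < T) :
    ∫ ω, rhoPath σn k x T ω ∂P ≤ rho σn k T m := by
  simpa using integral_mono (μ := P) (h.integrable_rhoPath hk hσn hk_le hk_pos hT)
    (integrable_const (rho σn k T m))
    fun ω => rhoPath_le_rho hk hσn hk_le hk_pos x hT ω

theorem integral_regret_le_add_excess [Nonempty X] (h : IsRun P σn k m f ε U g x)
    (hk : (Matrix.of k).PosSemidef) (hσn : 0 < σn) (hk_le : ∀ z, k z z ≤ 1)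
    (hk_pos : ∀ z, 0 < k z z) {T : ℕ} (hT : 0 < T) {β : ℝ} (hβ : 0 < β) :
    ∫ ω, regret f x T ω ∂P ≤
      √(2 * (1 + σn ^ 2)) * √((T * m : ℕ) * maxInfoGain σn k (T * m)) *
        ((∫ ω, rhoPath σn k x T ω ∂P) * β +
          √(1 + m / σn ^ 2) * ∫ ω, excess σn k f ε g x β T ω ∂P) := by
  have h_rhoPath := (h.integrable_rhoPath hk hσn hk_le hk_pos hT).mul_const β
  have h_excess := (h.integrable_excess hk hσn hk_pos hβ T).const_mul √(1 + m / σn ^ 2)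
  rw [h.integral_regret_eq hk hσn T, ← integral_mul_const, ← integral_const_mul,
    ← integral_add h_rhoPath h_excess, ← integral_const_mul]
  exact integral_mono_ae (integrable_finsetSum _ fun t _ => integrable_finsetSum _ fun i _ =>
    h.integrable_iSup_draw_sub_postMean hk t i) ((h_rhoPath.add h_excess).const_mul _)
    (h.sum_iSup_draw_sub_postMean_le hk hσn hk_le hk_pos hT hβ.le)

/-- At the level `β = √(2 log (D n³))` the excess has expectation at most `2 / n`, which makes up
for the crude bound `√(1 + m / σn²) = O(n)` on the ratio that multiplies it. -/
theorem integral_regret_le [Nonempty X] (h : IsRun P σn k m f ε U g x)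
    (hk : (Matrix.of k).PosSemidef) (hσn : 0 < σn) (hk_le : ∀ z, k z z ≤ 1)
    (hk_pos : ∀ z, 0 < k z z) (hD : 2 ≤ Fintype.card X) (hm : 0 < m) {T : ℕ} (hT : 0 < T) :
    ∫ ω, regret f x T ω ∂P ≤ √(2 * (1 + σn ^ 2)) * (√2 + 4 * √(1 + 1 / σn ^ 2)) *
      ((∫ ω, rhoPath σn k x T ω ∂P) * √((T * m : ℕ) * maxInfoGain σn k (T * m)) *
        √(Real.log (Fintype.card X * ((T * m : ℕ) : ℝ) ^ 3))) := by
  have hD' : (2 : ℝ) ≤ Fintype.card X := by exact_mod_cast hD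
  have hn : (1 : ℝ) ≤ (T * m : ℕ) := by exact_mod_cast Nat.mul_pos hT hm
  have hmn : (m : ℝ) ≤ (T * m : ℕ) := by exact_mod_cast Nat.le_mul_of_pos_left m hT
  have h_log := half_le_log_mul_pow hD' hn 3
  have hβ : 0 < √(2 * Real.log (Fintype.card X * ((T * m : ℕ) : ℝ) ^ 3)) :=
    Real.sqrt_pos.2 (by linarith)
  have h_excess := (h.integral_excess_le hk hσn hk_pos hβ T).trans (mul_gaussian_tail_le hD' hn)
  have h_bound := mul_sqrt_two_mul_add_le (h.one_le_integral_rhoPath hk hσn hk_le hk_pos hT) h_log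
    (zero_lt_one.trans_le hn) (Real.sqrt_nonneg _)
    (sqrt_one_add_div_le_mul hn hmn (sq_nonneg σn)) h_excess
  refine (h.integral_regret_le_add_excess hk hσn hk_le hk_pos hT hβ).trans
    ((mul_le_mul_of_nonneg_left h_bound (by positivity)).trans_eq ?_)
  ring

end IsRun

end

end BatchTS

theorem mainTheorem1 (σn : ℝ) (hσn : 0 < σn) :
    ∃ C : ℝ, 0 < C ∧
      ∀ (X : Type*) [Fintype X] [DecidableEq X] [MeasurableSpace X] [DiscreteMeasurableSpace X]
        (k : X → X → ℝ)
        (_hD : 2 ≤ Fintype.card X)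
        (_hk : (Matrix.of k).PosSemidef)
        (_hk_pos : ∀ z, 0 < k z z)
        (_hk_le : ∀ z z', k z z' ≤ 1)
        (Ω : Type*) [MeasurableSpace Ω] (P : Measure Ω) [IsProbabilityMeasure P]
        (𝒰 : Type*) [MeasurableSpace 𝒰]
        (m : ℕ) (_hm : 1 ≤ m)
        (f : Ω → X → ℝ) (ε : Ω → ℕ → Fin m → ℝ) (U : Ω → 𝒰)
        (g : ℕ → Ω → Fin m → X → ℝ) (x : ℕ → Ω → Fin m → X)
        (_hrun : BatchTS.IsRun P σn k m f ε U g x)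
        (T : ℕ) (_hT : 1 ≤ T),
        Integrable (BatchTS.regret f x T) P ∧
        Integrable (BatchTS.rhoPath σn k x T) P ∧
        ∫ ω, BatchTS.regret f x T ω ∂P ≤
          C * ((∫ ω, BatchTS.rhoPath σn k x T ω ∂P) *
            √((T * m : ℕ) * BatchTS.maxInfoGain σn k (T * m)) *
            √(Real.log (Fintype.card X * ((T * m : ℕ) : ℝ) ^ 3))) ∧
        ∫ ω, BatchTS.regret f x T ω ∂P ≤
          C * (BatchTS.rho σn k T m *
            √((T * m : ℕ) * BatchTS.maxInfoGain σn k (T * m)) *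
            √(Real.log (Fintype.card X * ((T * m : ℕ) : ℝ) ^ 3))) := by
  refine ⟨√(2 * (1 + σn ^ 2)) * (√2 + 4 * √(1 + 1 / σn ^ 2)), by positivity, ?_⟩
  intro X _ _ _ _ k hD hk hk_pos hk_le Ω _ P _ 𝒰 _ m hm f ε U g x hrun T hT
  have : Nonempty X := Fintype.card_pos_iff.1 (zero_lt_two.trans_le hD)
  have hk_diag (z : X) : k z z ≤ 1 := hk_le z z
  have h_regret := hrun.integral_regret_le hk hσn hk_diag hk_pos hD hm hT
  have h_rho := hrun.integral_rhoPath_le_rho hk hσn hk_diag hk_pos hT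
  exact ⟨hrun.integrable_regret T, hrun.integrable_rhoPath hk hσn hk_diag hk_pos hT, h_regret,
    h_regret.trans (by gcongr)⟩
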